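/- Let $n\ge 2$ and $k\ge 1$ be integers and let $\varphi:(0,\infty)\to\mathbb{R}$ be a $C^{k+2}$ function with $$\lim_{s\to\infty}\varphi(s)=\infty,\qquad \lim_{s\to\infty}\varphi'(s)=\cdots=\lim_{s\to\infty}\varphi^{(k+2)}(s)=0 .$$ Then there is a compactly supported function $u:\mathbb{R}^n\to\mathbb{R}$, depending on $\varphi$, such that $u$ is $(k+2)$-times differentiable everywhere in $\mathbb{R}^n$, $\Delta u\in C^k(\mathbb{R}^n)$, and $D^{k+2}u$ is unbounded; in particular $u\notin C^{k+2}(\mathbb{R}^n)$. Moreover, $u$ can be taken to be the real or the imaginary part of a function of the form $$\sum_{l=1}^{\infty}\epsilon_l\, r_l^{\,k+2}\,u_{t_l}\!\left(\frac{x-R_l\zeta_0}{r_l}\right),\qquad \zeta_0=\left(\tfrac1{\sqrt2},\dots,\tfrac1{\sqrt2}\right),\qquad \epsilon_l=\frac{1}{\sqrt{\varphi\left(1/(2t_l)\right)}},$$ where, with $z=x_1+ix_2$, $u_t(x)=\eta(|x|)\,z^{k+2}|x|^{2t}\varphi(-\ln|x|^2)$ for $0<|x|<1$ and $u_t(x)=0$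 for $x=0$ and for $|x|\ge 1$. Here $\eta:[0,\infty)\to[0,1]$ is a non-increasing $C^\infty$ function with $\eta=1$ on $[0,\frac12]$ and $\eta=0$ on $[\frac23,\infty)$; $(R_l)$ and $(r_l)$ are strictly decreasing sequences tending to $0$ with $R_l>r_l$ and $R_l-r_l>R_{l+1}+r_{l+1}$ for all $l$; and $0<t_l<\frac14$, $t_l\to0$, $\varphi(1/(2t_l))>0$ for all $l$. -/

import Mathlib

open scoped ContDiff Topology Laplacian

/-- `u` is `m` times differentiable everywhere: every derivative of order `j < m` is (Fréchet)
differentiable at every point; nothing is said about continuity of the `m`-th derivative. -/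
def TimesDifferentiable {E F : Type*} [NormedAddCommGroup E] [NormedSpace ℝ E]
    [NormedAddCommGroup F] [NormedSpace ℝ F] (m : ℕ) (u : E → F) : Prop :=
  ∀ j < m, Differentiable ℝ (iteratedFDeriv ℝ j u)

/-- `η : [0, ∞) → [0, 1]` is a non-increasing `C^∞` function, equal to `1` on `[0, 1/2]` and to `0`
on `[2/3, ∞)`. (Only the values on `[0, ∞)` matter.) -/
structure IsRadialCutoff (η : ℝ → ℝ) : Prop where
  smooth : ContDiffOn ℝ ∞ η (Set.Ici 0)
  mapsTo : Set.MapsTo η (Set.Ici 0) (Set.Icc 0 1)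
  antitone : AntitoneOn η (Set.Ici 0)
  eq_one : ∀ s ∈ Set.Icc (0 : ℝ) (1 / 2), η s = 1
  eq_zero : ∀ s, 2 / 3 ≤ s → η s = 0

/-- Conditions on the centres `R l`, the scales `r l` and the exponents `t l` of the glued sum.
The last one makes the coefficients `1 / √(φ (1 / (2 t_l)))` meaningful. -/
structure IsGluingData (φ : ℝ → ℝ) (R r t : ℕ → ℝ) : Prop where
  R_anti : StrictAnti R
  R_lim : Filter.Tendsto R Filter.atTop (𝓝 0)
  r_anti : StrictAnti r
  r_lim : Filter.Tendsto r Filter.atTop (𝓝 0)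
  r_lt_R : ∀ l, r l < R l
  separated : ∀ l, R (l + 1) + r (l + 1) < R l - r l
  t_pos : ∀ l, 0 < t l
  t_lt : ∀ l, t l < 1 / 4
  t_lim : Filter.Tendsto t Filter.atTop (𝓝 0)
  φ_pos : ∀ l, 0 < φ (1 / (2 * t l))

/-- The complex coordinate `z = x₁ + i x₂` on `ℝⁿ`, `n ≥ 2`. -/
def zCoord {n : ℕ} (hn : 2 ≤ n) (x : EuclideanSpace ℝ (Fin n)) : ℂ :=
  ⟨x ⟨0, by omega⟩, x ⟨1, by omega⟩⟩

open Classical in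
/-- The building block: `η(|x|) z^{k+2} |x|^{2t} φ(-ln |x|²)` for `0 < |x| < 1`, and `0` at the
origin and for `|x| ≥ 1`. -/
noncomputable def buildingBlock {n : ℕ} (hn : 2 ≤ n) (k : ℕ) (φ η : ℝ → ℝ) (t : ℝ)
    (x : EuclideanSpace ℝ (Fin n)) : ℂ :=
  if 0 < ‖x‖ ∧ ‖x‖ < 1 then
    (η ‖x‖ : ℂ) * zCoord hn x ^ (k + 2) * ((‖x‖ ^ (2 * t) : ℝ) : ℂ)
      * (φ (-Real.log (‖x‖ ^ 2)) : ℂ)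
  else 0

/-- The point `ζ₀ = (1/√2, …, 1/√2)` of `ℝⁿ`. -/
noncomputable def zetaZero (n : ℕ) : EuclideanSpace ℝ (Fin n) :=
  WithLp.toLp 2 fun _ => 1 / √2

/-- The glued sum `∑ₗ εₗ rₗ^{k+2} u_{tₗ}((x - Rₗ ζ₀) / rₗ)`, where `u_t` is the building block and
`εₗ = 1 / √(φ (1 / (2 tₗ)))`. -/
noncomputable def gluedSum {n : ℕ} (hn : 2 ≤ n) (k : ℕ) (φ η : ℝ → ℝ) (R r t : ℕ → ℝ)
    (x : EuclideanSpace ℝ (Fin n)) : ℂ :=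
  ∑' l : ℕ, ((1 / √(φ (1 / (2 * t l))) * r l ^ (k + 2) : ℝ) : ℂ) *
    buildingBlock hn k φ η (t l) ((r l)⁻¹ • (x - R l • zetaZero n))

/-! In the variable `s = -ln |x|²` a block is `e^{-ts} ψ(s) z^{k+2}`, where `ψ` is `φ` cut off near
`s = 0`. Since `φ', …, φ^{(k+2)}` tend to `0`, the derivatives of `ψ` of positive order are bounded
and `ψ` grows at most linearly. The argument rests on three properties of the block.

For fixed `t > 0` the factor `e^{-ts}` beats the linear growth. The derivatives of order `j` are
then `o(|x|^{k+2-j})` at the origin, so the block is `C^{k+2}` with vanishing derivatives there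
(`IsProfile.contDiff_profileBlock`).

Because `z^{k+2}` is harmonic, the Laplacian involves only derivatives of `e^{-ts} ψ(s)` of positive
order. These are bounded uniformly in `t`, because `t s e^{-ts} ≤ 1`; hence so are the derivatives
of the Laplacian up to order `k` (`exists_bound_laplacian_profileBlock`).

At `|x| = e^{-1/(4t)}` the real part of the block can equal `e^{-1/2} φ(1/(2t)) |x|^{k+2}`. By
Taylor's inequality at the origin, its derivative of order `k+2` must somewhere reach size `e^{-1/2}
φ(1/(2t))`, which is unbounded as `t → 0`.

The weight `ε = φ(1/(2t))^{-1/2}` lies between these regimes: `ε → 0`, while `ε φ = √φ → ∞`.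
Rescaled copies are placed in disjoint balls accumulating only at the origin. The factor `r^{k+2}`
makes the derivative of order `k+2` scale invariant, so it stays unbounded on the sum. Summable
weights make the Laplacian series converge in `C^k`. Small radii make every derivative of order at
most `k+1` be `O(|x|²)`, which yields the last differentiation at the origin
(`IsGluable.timesDifferentiable_sum`). -/

open Filter Set

/-! ### Cutoff and profile in the logarithmic variable. -/

/-- A smooth radial cutoff obtained from `Real.smoothTransition`. -/
noncomputable def radialCutoff (s : ℝ) : ℝ := Real.smoothTransition (4 - 6 * s)

lemma contDiff_radialCutoff {m : ℕ∞} : ContDiff ℝ m radialCutoff :=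
  Real.smoothTransition.contDiff.comp (by fun_prop)

lemma radialCutoff_eq_zero {s : ℝ} (hs : 2 / 3 ≤ s) : radialCutoff s = 0 :=
  Real.smoothTransition.zero_of_nonpos (by linarith)

lemma radialCutoff_eq_one {s : ℝ} (hs : s ≤ 1 / 2) : radialCutoff s = 1 :=
  Real.smoothTransition.one_of_one_le (by linarith)

lemma isRadialCutoff_radialCutoff : IsRadialCutoff radialCutoff where
  smooth := contDiff_radialCutoff.contDiffOn
  mapsTo := fun _ _ => ⟨Real.smoothTransition.nonneg _, Real.smoothTransition.le_one _⟩
  antitone := fun a _ b _ hab => Real.smoothTransition.monotone (by linarith)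
  eq_one := fun _ hs => radialCutoff_eq_one hs.2
  eq_zero := fun _ hs => radialCutoff_eq_zero hs

/-- The profile `s ↦ η(e^{-s/2}) φ(s)`, extended by zero to `s ≤ 0`. -/
noncomputable def cutProfile (φ : ℝ → ℝ) (s : ℝ) : ℝ :=
  if 0 < s then radialCutoff (Real.exp (-s / 2)) * φ s else 0

lemma cutProfile_of_lt {φ : ℝ → ℝ} {s : ℝ} (hs : s < 1 / 2) : cutProfile φ s = 0 := by
  unfold cutProfile
  split_ifs
  · rw [radialCutoff_eq_zero, zero_mul]
    have := Real.add_one_le_exp (-s / 2)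
    linarith
  · rfl

/-- From `s = 2` on, `e^{-s/2} ≤ e^{-1} < 1/2`. The condition `t < 1/4` puts the evaluation point
`1/(2t)` in this range. -/
lemma cutProfile_of_two_le {φ : ℝ → ℝ} {s : ℝ} (hs : 2 ≤ s) : cutProfile φ s = φ s := by
  rw [cutProfile, if_pos (by linarith), radialCutoff_eq_one, one_mul]
  have h1 : Real.exp (-s / 2) ≤ Real.exp (-1) := Real.exp_le_exp.2 (by linarith)
  have h2 := Real.exp_neg_one_lt_half
  linarith

lemma contDiff_cutProfile {φ : ℝ → ℝ} {m : ℕ} (hφ : ContDiffOn ℝ m φ (Ioi 0)) :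
    ContDiff ℝ m (cutProfile φ) := by
  rw [contDiff_iff_contDiffAt]
  intro s
  rcases lt_or_ge s (1 / 2) with hs | hs
  · refine (contDiffAt_const (c := (0 : ℝ))).congr_of_eventuallyEq ?_
    filter_upwards [Iio_mem_nhds hs] with y hy using cutProfile_of_lt hy
  · have hs0 : 0 < s := by linarith
    have h1 : ContDiffAt ℝ m (fun s => radialCutoff (Real.exp (-s / 2)) * φ s) s := by
      refine ContDiffAt.mul ?_ (hφ.contDiffAt (Ioi_mem_nhds hs0))
      exact (contDiff_radialCutoff.comp (by fun_prop :
        ContDiff ℝ (m : ℕ∞) fun s : ℝ => Real.exp (-s / 2))).contDiffAt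
    refine h1.congr_of_eventuallyEq ?_
    filter_upwards [Ioi_mem_nhds hs0] with y hy
    exact if_pos hy

/-- A continuous function on the line that vanishes on a left half-line and tends to `0` at `∞` is
bounded. -/
lemma exists_bound_of_tendsto_zero {f : ℝ → ℝ} (hf : Continuous f) (h0 : ∀ s < 0, f s = 0)
    (hlim : Tendsto f atTop (𝓝 0)) : ∃ M, ∀ s, |f s| ≤ M := by
  have h1 : ∀ᶠ s in atTop, |f s| < 1 := by
    have := hlim.abs
    rw [abs_zero] at this
    exact this.eventually (gt_mem_nhds one_pos)
  obtain ⟨S, hS⟩ := eventually_atTop.1 h1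
  obtain ⟨C, hC⟩ := (isCompact_Icc (a := (0 : ℝ)) (b := S)).exists_bound_of_continuousOn
    hf.continuousOn
  refine ⟨max 1 C, fun s => ?_⟩
  rcases lt_or_ge s 0 with h | h
  · rw [h0 s h, abs_zero]
    exact le_max_of_le_left zero_le_one
  · rcases le_total s S with h' | h'
    · exact le_max_of_le_right (hC s ⟨h, h'⟩)
    · exact le_max_of_le_left (hS s h').le

/-- `ψ` is `C^m`, vanishes on `(-∞, 1/2)` and its derivatives of orders `1, …, m` are bounded
by `M`. -/
structure IsProfile (m : ℕ) (M : ℝ) (ψ : ℝ → ℝ) : Prop where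
  smooth : ContDiff ℝ m ψ
  eq_zero : ∀ s < 1 / 2, ψ s = 0
  bound : ∀ i, 1 ≤ i → i ≤ m → ∀ s, |iteratedDeriv i ψ s| ≤ M

lemma IsProfile.iteratedDeriv_eq_zero {m : ℕ} {M : ℝ} {ψ : ℝ → ℝ} (h : IsProfile m M ψ) (i : ℕ)
    {s : ℝ} (hs : s < 1 / 2) : iteratedDeriv i ψ s = 0 := by
  have : ψ =ᶠ[𝓝 s] fun _ => 0 := by
    filter_upwards [Iio_mem_nhds hs] with y hy using h.eq_zero y hy
  rw [this.iteratedDeriv_eq]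
  simp

/-- Past `s = 2` the derivatives are those of `φ`, which tend to `0`; to the left of `1/2` they
vanish; compactness handles the rest. -/
lemma exists_isProfile_cutProfile {φ : ℝ → ℝ} {m : ℕ} (hφ : ContDiffOn ℝ m φ (Ioi 0))
    (hφ_deriv : ∀ j : ℕ, 1 ≤ j → j ≤ m → Tendsto (iteratedDeriv j φ) atTop (𝓝 0)) :
    ∃ M, 0 ≤ M ∧ IsProfile m M (cutProfile φ) := by
  have hsm := contDiff_cutProfile hφ
  have key : ∀ i : ℕ, ∃ M, 1 ≤ i → i ≤ m → ∀ s, |iteratedDeriv i (cutProfile φ) s| ≤ M := by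
    intro i
    by_cases hi : 1 ≤ i ∧ i ≤ m
    · have hlim : Tendsto (iteratedDeriv i (cutProfile φ)) atTop (𝓝 0) := by
        refine (hφ_deriv i hi.1 hi.2).congr' ?_
        filter_upwards [eventually_gt_atTop 2] with s hs
        refine (Filter.EventuallyEq.iteratedDeriv_eq i ?_).symm
        filter_upwards [Ioi_mem_nhds hs] with y hy using cutProfile_of_two_le (le_of_lt hy)
      obtain ⟨M, hM⟩ := exists_bound_of_tendsto_zero
        (hsm.continuous_iteratedDeriv i (by exact_mod_cast hi.2)) (fun s hs => by
          have : cutProfile φ =ᶠ[𝓝 s] fun _ => 0 := by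
            filter_upwards [Iio_mem_nhds hs] with y hy using
              cutProfile_of_lt (lt_trans hy (by norm_num))
          rw [this.iteratedDeriv_eq]
          simp) hlim
      exact ⟨M, fun _ _ => hM⟩
    · exact ⟨0, fun h1 h2 => absurd ⟨h1, h2⟩ hi⟩
  choose M hM using key
  refine ⟨∑ i ∈ Finset.range (m + 1), |M i|, Finset.sum_nonneg fun _ _ => abs_nonneg _,
    hsm, fun s hs => cutProfile_of_lt hs, fun i h1 h2 s => ?_⟩
  exact ((hM i h1 h2 s).trans (le_abs_self _)).trans
    (Finset.single_le_sum (f := fun i => |M i|) (fun _ _ => abs_nonneg _)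
      (Finset.mem_range.2 (by omega)))

/-- Mean value inequality from `ψ 0 = 0`. This linear growth is the only control on `ψ` itself. -/
lemma IsProfile.abs_le {m : ℕ} {M : ℝ} {ψ : ℝ → ℝ} (h : IsProfile m M ψ) (hm : 1 ≤ m) (s : ℝ) :
    |ψ s| ≤ M * |s| := by
  have hd : Differentiable ℝ ψ := h.smooth.differentiable (by exact_mod_cast (by omega : m ≠ 0))
  have := convex_univ.norm_image_sub_le_of_norm_deriv_le (f := ψ) (C := M) (x := 0) (y := s)
    (fun x _ => hd x) (fun x _ => by simpa using h.bound 1 le_rfl hm x) trivial trivial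
  simpa [h.eq_zero 0 (by norm_num)] using this

/-! ### Estimates for the damped profile. -/

/-- The exponentially damped profile `s ↦ e^{-ts} ψ(s)`. -/
noncomputable def damped (ψ : ℝ → ℝ) (t s : ℝ) : ℝ := Real.exp (-t * s) * ψ s

lemma IsProfile.contDiff_damped {m : ℕ} {M : ℝ} {ψ : ℝ → ℝ} (h : IsProfile m M ψ) (t : ℝ) :
    ContDiff ℝ m (damped ψ t) :=
  ContDiff.mul (by fun_prop) h.smooth

lemma IsProfile.iteratedDeriv_damped {m : ℕ} {M : ℝ} {ψ : ℝ → ℝ} (h : IsProfile m M ψ) {i : ℕ}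
    (hi : i ≤ m) (t s : ℝ) : iteratedDeriv i (damped ψ t) s =
      ∑ a ∈ Finset.range (i + 1), (i.choose a : ℝ) * ((-t) ^ a * Real.exp (-t * s))
        * iteratedDeriv (i - a) ψ s := by
  have h1 : damped ψ t = (fun s => Real.exp (-t * s)) * ψ := rfl
  rw [h1, iteratedDeriv_mul (n := i)]
  · simp only [iteratedDeriv_exp_const_mul]
  · exact ContDiff.contDiffAt (by fun_prop)
  · exact (h.smooth.of_le (by exact_mod_cast hi)).contDiffAt

lemma abs_iteratedDeriv_damped_le_of_terms {m : ℕ} {M : ℝ} {ψ : ℝ → ℝ} (h : IsProfile m M ψ)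
    {i : ℕ} (hi : i ≤ m) {t s B : ℝ}
    (hB : ∀ a ≤ i, |t| ^ a * Real.exp (-t * s) * |iteratedDeriv (i - a) ψ s| ≤ B) :
    |iteratedDeriv i (damped ψ t) s| ≤ 2 ^ i * B := by
  rw [h.iteratedDeriv_damped hi]
  refine (Finset.abs_sum_le_sum_abs _ _).trans ?_
  have h2 : (2 : ℝ) ^ i * B = ∑ a ∈ Finset.range (i + 1), (i.choose a : ℝ) * B := by
    rw [← Finset.sum_mul]
    congr 1
    exact_mod_cast (Nat.sum_range_choose i).symm
  rw [h2]
  refine Finset.sum_le_sum fun a ha => ?_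
  rw [abs_mul, abs_mul, abs_mul, abs_pow, abs_neg, abs_of_nonneg (Nat.cast_nonneg _),
    abs_of_pos (Real.exp_pos _), mul_assoc]
  exact mul_le_mul_of_nonneg_left (hB a (by simpa [Nat.lt_succ_iff] using ha))
    (Nat.cast_nonneg _)

/-- All derivatives of the damped profile decay. -/
lemma IsProfile.abs_iteratedDeriv_damped_le {m : ℕ} {M : ℝ} {ψ : ℝ → ℝ} (h : IsProfile m M ψ)
    (hM : 0 ≤ M) (hm : 1 ≤ m) {i : ℕ} (hi : i ≤ m) {t s : ℝ} (ht : 0 < t) (ht1 : t ≤ 1)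
    (hs : 0 ≤ s) :
    |iteratedDeriv i (damped ψ t) s| ≤ 2 ^ i * (M * (1 + s) * Real.exp (-t * s)) := by
  refine abs_iteratedDeriv_damped_le_of_terms h hi fun a ha => ?_
  rw [abs_of_pos ht]
  have h1 : |iteratedDeriv (i - a) ψ s| ≤ M * (1 + s) := by
    rcases Nat.eq_zero_or_pos (i - a) with h0 | h0
    · rw [h0, iteratedDeriv_zero]
      refine (h.abs_le hm s).trans ?_
      rw [abs_of_nonneg hs]
      nlinarith
    · refine (h.bound _ h0 (by omega) s).trans ?_
      nlinarith
  calc t ^ a * Real.exp (-t * s) * |iteratedDeriv (i - a) ψ s|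
      ≤ 1 * Real.exp (-t * s) * (M * (1 + s)) := by
        gcongr
        exact pow_le_one₀ ht.le ht1
    _ = _ := by ring

/-- The derivatives of positive order of the damped profile are bounded uniformly in `t`. -/
lemma IsProfile.abs_iteratedDeriv_damped_le_const {m : ℕ} {M : ℝ} {ψ : ℝ → ℝ}
    (h : IsProfile m M ψ) (hM : 0 ≤ M) (hm : 1 ≤ m) {i : ℕ} (hi1 : 1 ≤ i) (hi : i ≤ m) {t : ℝ}
    (ht : 0 < t) (ht1 : t ≤ 1) (s : ℝ) :
    |iteratedDeriv i (damped ψ t) s| ≤ 2 ^ i * M := by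
  refine abs_iteratedDeriv_damped_le_of_terms h hi fun a ha => ?_
  rcases lt_or_ge s (1 / 2) with hs | hs
  · rw [h.iteratedDeriv_eq_zero _ hs]
    simpa using hM
  have hs0 : 0 ≤ s := by linarith
  rw [abs_of_pos ht]
  have he : Real.exp (-t * s) ≤ 1 := Real.exp_le_one_iff.2 (by nlinarith)
  have hte : t * s * Real.exp (-t * s) ≤ 1 := by
    have h1 : t * s ≤ Real.exp (t * s) := by linarith [Real.add_one_le_exp (t * s)]
    calc t * s * Real.exp (-t * s) ≤ Real.exp (t * s) * Real.exp (-t * s) := by gcongr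
      _ = 1 := by rw [← Real.exp_add]; simp
  -- Only the Leibniz term `a = i` contains `ψ` undifferentiated. As `i ≥ 1`, it carries a factor
  -- `t`, which pays for the linear growth of `ψ`.
  rcases Nat.eq_zero_or_pos (i - a) with h0 | h0
  · rw [h0, iteratedDeriv_zero]
    have h2 : t ^ a ≤ t := pow_le_of_le_one ht.le ht1 (by omega)
    calc t ^ a * Real.exp (-t * s) * |ψ s| ≤ t * Real.exp (-t * s) * (M * s) := by
          gcongr
          simpa [abs_of_nonneg hs0] using h.abs_le hm s
      _ = M * (t * s * Real.exp (-t * s)) := by ring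
      _ ≤ M * 1 := by gcongr
      _ = M := mul_one M
  · calc t ^ a * Real.exp (-t * s) * |iteratedDeriv (i - a) ψ s| ≤ 1 * 1 * M := by
          gcongr
          · exact pow_le_one₀ ht.le ht1
          · exact h.bound _ h0 (by omega) s
      _ = M := by ring

lemma IsProfile.tendsto_iteratedDeriv_damped {m : ℕ} {M : ℝ} {ψ : ℝ → ℝ} (h : IsProfile m M ψ)
    (hM : 0 ≤ M) (hm : 1 ≤ m) {i : ℕ} (hi : i ≤ m) {t : ℝ} (ht : 0 < t) (ht1 : t ≤ 1) :
    Tendsto (iteratedDeriv i (damped ψ t)) atTop (𝓝 0) := by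
  have h1 : Tendsto (fun s : ℝ => 2 ^ i * (M * (1 + s) * Real.exp (-t * s))) atTop (𝓝 0) := by
    have h2 := tendsto_rpow_mul_exp_neg_mul_atTop_nhds_zero 1 t ht
    have h3 := tendsto_rpow_mul_exp_neg_mul_atTop_nhds_zero 0 t ht
    have h4 := (h2.add h3).const_mul (2 ^ i * M)
    simp only [add_zero, mul_zero, Real.rpow_one, Real.rpow_zero] at h4
    refine h4.congr fun s => by ring
  refine squeeze_zero_norm' ?_ h1
  filter_upwards [eventually_ge_atTop 0] with s hs
  exact h.abs_iteratedDeriv_damped_le hM hm hi ht ht1 hs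

/-! ### Derivatives under affine changes of variable. -/

section Scaling

variable {E F : Type*} [NormedAddCommGroup E] [NormedSpace ℝ E] [NormedAddCommGroup F]
  [NormedSpace ℝ F]

/-- Iterated derivatives of `x ↦ f (c • x)`, with no regularity assumption on `f`. -/
lemma iteratedFDeriv_comp_smul (c : ℝ) (f : E → F) (j : ℕ) :
    iteratedFDeriv ℝ j (fun x => f (c • x)) = fun x => c ^ j • iteratedFDeriv ℝ j f (c • x) := by
  induction j with
  | zero => ext; simp
  | succ i ih =>
    ext x v
    have hsmul : fderiv ℝ (fun x => c ^ i • iteratedFDeriv ℝ i f (c • x)) =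
        c ^ i • fderiv ℝ (fun x => iteratedFDeriv ℝ i f (c • x)) :=
      fderiv_const_smul_field (f := fun x => iteratedFDeriv ℝ i f (c • x)) (c ^ i)
    rw [iteratedFDeriv_succ_apply_left, ih, hsmul,
      smul_apply, iteratedFDeriv_succ_apply_left, pow_succ, Pi.smul_apply]
    have := fderiv_comp_smul (f := iteratedFDeriv ℝ i f) (x := x) (c := c)
    rw [this]
    simp [smul_smul]

lemma norm_iteratedFDeriv_comp_affine {c : ℝ} (hc : 0 ≤ c) (a : E) (f : E → F) (j : ℕ) (x : E) :
    ‖iteratedFDeriv ℝ j (fun x => f (c • (x - a))) x‖ =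
      c ^ j * ‖iteratedFDeriv ℝ j f (c • (x - a))‖ := by
  rw [iteratedFDeriv_comp_sub j a (f := fun y => f (c • y)), iteratedFDeriv_comp_smul, norm_smul,
    Real.norm_of_nonneg (pow_nonneg hc j)]

end Scaling

/-! ### Homogeneous functions times functions of `-ln |x|²`. -/

section Homogeneous

variable {E : Type*} [NormedAddCommGroup E] [InnerProductSpace ℝ E]

/-- The function `x ↦ -ln |x|²`. -/
noncomputable def negLogSq (x : E) : ℝ := -Real.log (‖x‖ ^ 2)

lemma contDiffOn_negLogSq {m : ℕ∞ω} : ContDiffOn ℝ m (negLogSq : E → ℝ) {0}ᶜ :=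
  ((contDiff_norm_sq ℝ).contDiffOn.log fun x hx => by simpa using hx).neg

lemma negLogSq_smul {c : ℝ} (hc : c ≠ 0) {x : E} (hx : x ≠ 0) :
    negLogSq (c • x) = -Real.log (c ^ 2) + negLogSq x := by
  unfold negLogSq
  rw [norm_smul, mul_pow, Real.log_mul (by simpa using hc) (by simpa using hx), Real.norm_eq_abs,
    sq_abs]
  ring

/-- `P` is smooth off the origin and positively homogeneous of degree `d`. -/
structure IsHomogeneousOffZero (d : ℕ) (P : E → ℂ) : Prop where
  smooth : ContDiffOn ℝ ∞ P {0}ᶜ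
  homog : ∀ c : ℝ, 0 < c → ∀ x, P (c • x) = c ^ d • P x

/-- Compactness of the sphere. Requiring `1 ≤ B` gives `B ≤ B ^ i`, the form needed by the bound for
derivatives of a composition. -/
lemma exists_bound_iteratedFDeriv_sphere [FiniteDimensional ℝ E] {F : Type*}
    [NormedAddCommGroup F] [NormedSpace ℝ F] {f : E → F}
    (hf : ContDiffOn ℝ ∞ f {0}ᶜ) (N : ℕ) :
    ∃ B, 1 ≤ B ∧ ∀ i ≤ N, ∀ x : E, ‖x‖ = 1 → ‖iteratedFDerivWithin ℝ i f {0}ᶜ x‖ ≤ B := by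
  have key : ∀ i : ℕ, ∃ B, ∀ x : E, ‖x‖ = 1 → ‖iteratedFDerivWithin ℝ i f {0}ᶜ x‖ ≤ B := by
    intro i
    have hsub : Metric.sphere (0 : E) 1 ⊆ {0}ᶜ := fun x hx => by
      rintro rfl
      simp at hx
    have h1 := (hf.continuousOn_iteratedFDerivWithin (m := i) (by exact_mod_cast le_top)
      isOpen_compl_singleton.uniqueDiffOn).mono hsub
    obtain ⟨B, hB⟩ := (isCompact_sphere (0 : E) 1).exists_bound_of_continuousOn h1
    exact ⟨B, fun x hx => hB x (by simpa using hx)⟩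
  choose B hB using key
  refine ⟨1 + ∑ i ∈ Finset.range (N + 1), |B i|,
    le_add_of_nonneg_right (Finset.sum_nonneg fun _ _ => abs_nonneg _), fun i hi x hx => ?_⟩
  refine ((hB i x hx).trans (le_abs_self _)).trans ?_
  have := Finset.single_le_sum (f := fun i => |B i|) (fun _ _ => abs_nonneg _)
    (Finset.mem_range.2 (by omega : i < N + 1))
  linarith

lemma contDiffOn_comp_negLogSq_smul {N : ℕ} {P : E → ℂ} (hP : ContDiffOn ℝ ∞ P {0}ᶜ) {h : ℝ → ℝ}
    (hh : ContDiff ℝ N h) : ContDiffOn ℝ N (fun x => h (negLogSq x) • P x) {0}ᶜ :=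
  (hh.comp_contDiffOn contDiffOn_negLogSq).smul (hP.of_le (by exact_mod_cast le_top))

/-- On the unit sphere, the derivatives of `h(-ln |x|² + s) P(x)` are controlled by those of `h`
at `s`. -/
lemma exists_bound_on_sphere [FiniteDimensional ℝ E] {P : E → ℂ} (hP : ContDiffOn ℝ ∞ P {0}ᶜ)
    (N : ℕ) :
    ∃ C, 0 ≤ C ∧ ∀ h : ℝ → ℝ, ContDiff ℝ N h → ∀ B, ∀ y : E, ‖y‖ = 1 →
      (∀ i ≤ N, |iteratedDeriv i h 0| ≤ B) →
      ∀ j ≤ N, ‖iteratedFDeriv ℝ j (fun x => h (negLogSq x) • P x) y‖ ≤ C * B := by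
  obtain ⟨A, hA1, hA⟩ := exists_bound_iteratedFDeriv_sphere hP N
  obtain ⟨D, hD1, hD⟩ := exists_bound_iteratedFDeriv_sphere (E := E)
    (contDiffOn_negLogSq (m := ∞)) N
  have hA0 : 0 ≤ A := by linarith
  have hD0 : 0 ≤ D := by linarith
  refine ⟨2 ^ N * (N.factorial * D ^ N) * A, by positivity, fun h hh B y hy hB j hj => ?_⟩
  have hB0 : 0 ≤ B := (abs_nonneg _).trans (hB 0 (Nat.zero_le _))
  have hU : IsOpen ({0}ᶜ : Set E) := isOpen_compl_singleton
  have hy0 : y ∈ ({0}ᶜ : Set E) := by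
    rintro rfl
    simp at hy
  have hLy : negLogSq y = 0 := by simp [negLogSq, hy]
  rw [← iteratedFDerivWithin_of_isOpen j hU hy0]
  refine (norm_iteratedFDerivWithin_smul_le (hh.comp_contDiffOn contDiffOn_negLogSq)
    (hP.of_le (by exact_mod_cast le_top)) hU.uniqueDiffOn hy0 (by exact_mod_cast hj)).trans ?_
  have hterm : ∀ i ∈ Finset.range (j + 1), (j.choose i : ℝ)
      * ‖iteratedFDerivWithin ℝ i (h ∘ negLogSq) {0}ᶜ y‖
      * ‖iteratedFDerivWithin ℝ (j - i) P {0}ᶜ y‖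
      ≤ (j.choose i : ℝ) * ((N.factorial * D ^ N) * A * B) := by
    intro i hi
    have hij : i ≤ j := by simpa [Nat.lt_succ_iff] using hi
    have h1 : ‖iteratedFDerivWithin ℝ i (h ∘ negLogSq) {0}ᶜ y‖ ≤ i.factorial * B * D ^ i := by
      refine norm_iteratedFDerivWithin_comp_le (N := N) (t := univ) hh.contDiffOn
        contDiffOn_negLogSq (by exact_mod_cast hij.trans hj) uniqueDiffOn_univ hU.uniqueDiffOn
        (mapsTo_univ _ _) hy0 (fun a ha => ?_) (fun a ha1 ha => ?_)
      · rw [iteratedFDerivWithin_univ, norm_iteratedFDeriv_eq_norm_iteratedDeriv, hLy]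
        exact hB a (by omega)
      · exact (hD a (by omega) y hy).trans (le_self_pow₀ hD1 (by omega))
    have h2 : (i.factorial : ℝ) * B * D ^ i ≤ N.factorial * B * D ^ N := by
      gcongr
      · omega
      · omega
    rw [mul_assoc]
    refine mul_le_mul_of_nonneg_left ?_ (Nat.cast_nonneg _)
    calc _ ≤ (N.factorial * B * D ^ N) * A :=
          mul_le_mul (h1.trans h2) (hA _ (by omega) y hy) (norm_nonneg _) (by positivity)
      _ = _ := by ring
  refine (Finset.sum_le_sum hterm).trans ?_
  rw [← Finset.sum_mul]
  have h3 : ∑ i ∈ Finset.range (j + 1), (j.choose i : ℝ) = 2 ^ j := by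
    exact_mod_cast Nat.sum_range_choose j
  rw [h3]
  calc (2 : ℝ) ^ j * ((N.factorial * D ^ N) * A * B)
      ≤ 2 ^ N * ((N.factorial * D ^ N) * A * B) := by
        gcongr
        norm_num
    _ = _ := by ring

/-- Derivative bounds for `h(-ln |x|²) P(x)` with `P` homogeneous of degree `d`, by scaling. -/
lemma IsHomogeneousOffZero.exists_bound [FiniteDimensional ℝ E] {d : ℕ} {P : E → ℂ}
    (hP : IsHomogeneousOffZero d P) (N : ℕ) :
    ∃ C, 0 ≤ C ∧ ∀ h : ℝ → ℝ, ContDiff ℝ N h → ∀ B, ∀ x : E, x ≠ 0 →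
      (∀ i ≤ N, |iteratedDeriv i h (negLogSq x)| ≤ B) →
      ∀ j ≤ N, ‖iteratedFDeriv ℝ j (fun y => h (negLogSq y) • P y) x‖ ≤
        C * B * (‖x‖ ^ d * (‖x‖⁻¹) ^ j) := by
  obtain ⟨C, hC0, hC⟩ := exists_bound_on_sphere hP.smooth N
  refine ⟨C, hC0, fun h hh B x hx hB j hj => ?_⟩
  have hx0 : 0 < ‖x‖ := norm_pos_iff.2 hx
  -- Rescaling `x` to the unit sphere shifts `-ln |·|²` by a constant and multiplies `P` by a power
  -- of `‖x‖`; `h'` absorbs both.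
  set h' : ℝ → ℝ := fun s => ‖x‖ ^ d * h (negLogSq x + s) with hh'
  have hh'c : ContDiff ℝ N h' := contDiff_const.mul (hh.comp (by fun_prop))
  have hnorm : ‖‖x‖⁻¹ • x‖ = 1 := by
    rw [norm_smul, norm_inv, norm_norm, inv_mul_cancel₀ hx0.ne']
  have hB' : ∀ i ≤ N, |iteratedDeriv i h' 0| ≤ ‖x‖ ^ d * B := by
    intro i hi
    have : iteratedDeriv i h' 0 = ‖x‖ ^ d * iteratedDeriv i h (negLogSq x) := by
      rw [hh', iteratedDeriv_const_mul_field,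
        iteratedDeriv_comp_const_add (n := i) (f := h) (s := negLogSq x)]
      simp
    rw [this, abs_mul, abs_of_nonneg (by positivity)]
    gcongr
    exact hB i hi
  have heq : (fun y => h (negLogSq y) • P y) =ᶠ[𝓝 x]
      fun y => (fun z => h' (negLogSq z) • P z) (‖x‖⁻¹ • y) := by
    filter_upwards [isOpen_compl_singleton.mem_nhds hx] with y hy
    have hlog : negLogSq x + negLogSq (‖x‖⁻¹ • y) = negLogSq y := by
      rw [negLogSq_smul (inv_ne_zero hx0.ne') hy, inv_pow, Real.log_inv]
      simp [negLogSq]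
    simp only [hh', hlog]
    rw [hP.homog _ (inv_pos.2 hx0), smul_smul, inv_pow]
    congr 1
    field_simp
  rw [(heq.iteratedFDeriv ℝ j).eq_of_nhds,
    iteratedFDeriv_comp_smul _ (fun z => h' (negLogSq z) • P z), norm_smul,
    Real.norm_of_nonneg (by positivity)]
  calc ‖x‖⁻¹ ^ j * _ ≤ ‖x‖⁻¹ ^ j * (C * (‖x‖ ^ d * B)) := by
        gcongr
        exact hC h' hh'c _ _ hnorm hB' j hj
    _ = _ := by ring

end Homogeneous

-- Regularity across the origin.

universe u in
/-- A function that is `C^N` off the origin, vanishes there, and whose derivatives of order `j` are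
`o(|x|^{N-j})`, is `C^N`, and its derivatives of order at most `N` vanish at the origin. -/
lemma contDiff_of_isLittleO {E : Type u} [NormedAddCommGroup E] [NormedSpace ℝ E] (N : ℕ) :
    ∀ {F : Type u} [NormedAddCommGroup F] [NormedSpace ℝ F] {f : E → F},
      ContDiffOn ℝ N f {0}ᶜ → f 0 = 0 →
      (∀ j ≤ N, (fun x => iteratedFDeriv ℝ j f x) =o[𝓝[≠] 0] fun x => ‖x‖ ^ (N - j)) →
      ContDiff ℝ N f ∧ ∀ j ≤ N, iteratedFDeriv ℝ j f 0 = 0 := by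
  -- The step applies the claim to `fderiv ℝ f`, so the target space must vary; `E →L[ℝ] F` stays in
  -- the common universe.
  induction N with
  | zero =>
    intro F _ _ f hf h0 ho
    have h1 : Tendsto f (𝓝[≠] 0) (𝓝 0) := by
      have h2 := ho 0 le_rfl
      simp only [tsub_self, pow_zero] at h2
      have h3 := ((Asymptotics.isLittleO_one_iff ℝ).1 h2).norm
      simp only [norm_iteratedFDeriv_zero, norm_zero] at h3
      exact tendsto_zero_iff_norm_tendsto_zero.2 h3
    refine ⟨?_, fun j hj => ?_⟩
    · rw [Nat.cast_zero, contDiff_zero, continuous_iff_continuousAt]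
      intro x
      rcases eq_or_ne x 0 with rfl | hx
      · rw [continuousAt_iff_punctured_nhds, h0]
        exact h1
      · exact hf.continuousOn.continuousAt (isOpen_compl_singleton.mem_nhds hx)
    · obtain rfl : j = 0 := by omega
      ext
      simpa using h0
  | succ N ih =>
    intro F _ _ f hf h0 ho
    have hd0 : HasFDerivAt f (0 : E →L[ℝ] F) 0 := by
      rw [hasFDerivAt_iff_isLittleO_nhds_zero]
      simp only [zero_add, h0, sub_zero, zero_apply]
      refine Asymptotics.isLittleO_iff.2 fun c hc => ?_
      filter_upwards [eventually_nhdsWithin_iff.1 (Asymptotics.isLittleO_iff.1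
        (ho 0 (Nat.zero_le _)) hc), Metric.ball_mem_nhds (0 : E) one_pos] with x hx hx1
      rcases eq_or_ne x 0 with rfl | hx0
      · simp [h0]
      · have h1 := hx hx0
        rw [norm_iteratedFDeriv_zero, norm_pow, norm_norm] at h1
        refine h1.trans (mul_le_mul_of_nonneg_left ?_ hc.le)
        exact pow_le_of_le_one (norm_nonneg _) (by simpa using (mem_ball_zero_iff.1 hx1).le)
          (by omega)
    have hdiff : Differentiable ℝ f := by
      intro x
      rcases eq_or_ne x 0 with rfl | hx
      · exact hd0.differentiableAt
      · exact (hf.contDiffAt (isOpen_compl_singleton.mem_nhds hx)).differentiableAt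
          (by exact_mod_cast Nat.succ_ne_zero N)
    have hrec := ih (f := fderiv ℝ f) (hf.fderiv_of_isOpen isOpen_compl_singleton
      (by push_cast; exact le_rfl)) hd0.fderiv (fun j hj => by
        refine (Asymptotics.isLittleO_norm_left.1 ?_)
        simp only [norm_iteratedFDeriv_fderiv]
        have := (ho (j + 1) (by omega)).norm_left
        simpa [Nat.add_sub_add_right] using this)
    refine ⟨?_, fun j hj => ?_⟩
    · rw [Nat.cast_add, Nat.cast_one, contDiff_succ_iff_fderiv]
      exact ⟨hdiff, by simp, hrec.1⟩
    · rcases j with _ | j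
      · ext
        simpa using h0
      · rw [← norm_eq_zero, ← norm_iteratedFDeriv_fderiv, hrec.2 j (by omega), norm_zero]

/-! ### The Laplacian in coordinates and under scaling. -/

section Laplacian

variable {E F : Type*} [NormedAddCommGroup E] [InnerProductSpace ℝ E] [FiniteDimensional ℝ E]
  [NormedAddCommGroup F] [NormedSpace ℝ F]

lemma laplacian_apply_eq_sum {ι : Type*} [Fintype ι] (b : OrthonormalBasis ι ℝ E) (f : E → F)
    (x : E) : (Δ f) x = ∑ i, fderiv ℝ (fderiv ℝ f) x (b i) (b i) := by
  simp [InnerProductSpace.laplacian_eq_iteratedFDeriv_orthonormalBasis f b,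
    iteratedFDeriv_two_apply]

lemma ContDiff.laplacian {f : E → F} {k : ℕ} (hf : ContDiff ℝ (k + 2 : ℕ) f) :
    ContDiff ℝ k (Δ f) := by
  have h1 : ContDiff ℝ (k + 1 : ℕ) (fderiv ℝ f) := hf.fderiv_right (by norm_cast)
  have h2 : ContDiff ℝ k (fderiv ℝ (fderiv ℝ f)) := h1.fderiv_right (by norm_cast)
  have h3 : Δ f = fun x => ∑ i, fderiv ℝ (fderiv ℝ f) x (stdOrthonormalBasis ℝ E i)
      (stdOrthonormalBasis ℝ E i) := by
    ext x
    exact laplacian_apply_eq_sum _ f x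
  rw [h3]
  exact ContDiff.sum fun i _ => (h2.clm_apply contDiff_const).clm_apply contDiff_const

lemma laplacian_comp_affine (c : ℝ) (a : E) (f : E → F) (x : E) :
    (Δ fun x => f (c • (x - a))) x = c ^ 2 • (Δ f) (c • (x - a)) := by
  rw [InnerProductSpace.laplacian_eq_iteratedFDeriv_stdOrthonormalBasis,
    InnerProductSpace.laplacian_eq_iteratedFDeriv_stdOrthonormalBasis]
  simp only [iteratedFDeriv_comp_sub _ a (f := fun y => f (c • y)), iteratedFDeriv_comp_smul,
    smul_apply, Finset.smul_sum]

end Laplacian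

/-! ### Second derivatives along lines. -/

section SecondDerivative

variable {E F : Type*} [NormedAddCommGroup E] [NormedSpace ℝ E] [NormedAddCommGroup F]
  [NormedSpace ℝ F]

/-- The second derivative of `f` in the direction `v`, computed along the line through `x`. -/
lemma fderiv_fderiv_apply_eq_of_hasDerivAt {f : E → F} {x v : E} (hf : ContDiffAt ℝ 2 f x)
    {g : ℝ → F} {a : F} (h1 : ∀ᶠ τ in 𝓝 (0 : ℝ), HasDerivAt (fun τ : ℝ => f (x + τ • v)) (g τ) τ)
    (h2 : HasDerivAt g a 0) : fderiv ℝ (fderiv ℝ f) x v v = a := by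
  have hline : ∀ τ : ℝ, HasDerivAt (fun τ : ℝ => x + τ • v) v τ := fun τ => by
    simpa using ((hasDerivAt_id τ).smul_const v).const_add x
  have hx0 : x + (0 : ℝ) • v = x := by simp
  have hev : ∀ᶠ τ in 𝓝 (0 : ℝ), DifferentiableAt ℝ f (x + τ • v) := by
    have hc : Tendsto (fun τ : ℝ => x + τ • v) (𝓝 0) (𝓝 x) := by
      simpa only [hx0] using (hline 0).continuousAt.tendsto
    have hd : ∀ᶠ y in 𝓝 x, DifferentiableAt ℝ f y := by
      filter_upwards [hf.eventually (by simp)] with y hy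
      exact hy.differentiableAt two_ne_zero
    exact hc.eventually hd
  have hg : g =ᶠ[𝓝 0] fun τ => fderiv ℝ f (x + τ • v) v := by
    filter_upwards [h1, hev] with τ hτ1 hτ2
    exact hτ1.unique (hτ2.hasFDerivAt.comp_hasDerivAt τ (hline τ))
  have hd1 : DifferentiableAt ℝ (fderiv ℝ f) x :=
    (hf.fderiv_right (m := 1) (by norm_num)).differentiableAt one_ne_zero
  have h3 : HasDerivAt (fun τ : ℝ => fderiv ℝ f (x + τ • v)) (fderiv ℝ (fderiv ℝ f) x v) 0 := by
    refine HasFDerivAt.comp_hasDerivAt (f := fun τ : ℝ => x + τ • v) 0 ?_ (hline 0)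
    rw [hx0]
    exact hd1.hasFDerivAt
  have h4 := h3.clm_apply (hasDerivAt_const (0 : ℝ) v)
  simp only [map_zero, add_zero] at h4
  exact (h4.congr_of_eventuallyEq hg).unique h2

end SecondDerivative

/-! ### The coordinate `z` and the Laplacian of `h(-ln |x|²) z^{k+2}`. -/

section Coordinate

variable {n : ℕ} (hn : 2 ≤ n)

/-- `zCoord` as a continuous linear map. -/
noncomputable def zCoordCLM : EuclideanSpace ℝ (Fin n) →L[ℝ] ℂ :=
  Complex.equivRealProdCLM.symm.toContinuousLinearMap.comp
    ((EuclideanSpace.proj (⟨0, by omega⟩ : Fin n)).prod (EuclideanSpace.proj ⟨1, by omega⟩))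

lemma zCoordCLM_apply (x : EuclideanSpace ℝ (Fin n)) : zCoordCLM hn x = zCoord hn x := by
  apply Complex.ext <;> simp [zCoordCLM, zCoord]

/-- This is `1 + i² = 0`, the source of the harmonicity of `z^{k+2}`: it removes the term with
undifferentiated `h`. -/
lemma sum_zCoord_basis_sq : ∑ i, zCoord hn (EuclideanSpace.basisFun (Fin n) ℝ i) ^ 2 = 0 := by
  have h : ∀ i : Fin n, zCoord hn (EuclideanSpace.basisFun (Fin n) ℝ i) ^ 2 =
      (if (⟨0, by omega⟩ : Fin n) = i then 1 else 0) -
        if (⟨1, by omega⟩ : Fin n) = i then 1 else 0 := by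
    intro i
    have h01 : ¬ ((⟨0, by omega⟩ : Fin n) = i ∧ (⟨1, by omega⟩ : Fin n) = i) := by
      rintro ⟨rfl, h⟩
      simp at h
    apply Complex.ext <;> simp only [zCoord, EuclideanSpace.basisFun_apply,
      PiLp.single_apply, pow_two] <;> split_ifs <;> simp_all
  simp only [h, Finset.sum_sub_distrib, Finset.sum_ite_eq, Finset.mem_univ, if_true, sub_self]

/-- Euler's identity for the linear function `z`; it turns the cross terms of the Laplacian into
multiples of `z^{k+2}`. -/
lemma sum_inner_smul_zCoord_basis (x : EuclideanSpace ℝ (Fin n)) :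
    ∑ i, (inner ℝ x (EuclideanSpace.basisFun (Fin n) ℝ i)) •
      zCoord hn (EuclideanSpace.basisFun (Fin n) ℝ i) = zCoord hn x := by
  have h := congrArg (zCoordCLM hn) ((EuclideanSpace.basisFun (Fin n) ℝ).sum_repr' x)
  rw [map_sum] at h
  simp only [map_smul, zCoordCLM_apply, real_inner_comm] at h ⊢
  exact h

lemma isHomogeneousOffZero_zCoord_pow (m : ℕ) :
    IsHomogeneousOffZero m fun x : EuclideanSpace ℝ (Fin n) => zCoord hn x ^ m where
  smooth := by
    simp only [← zCoordCLM_apply]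
    exact ((zCoordCLM hn).contDiff.pow m).contDiffOn
  homog c _ x := by
    simp only [← zCoordCLM_apply, map_smul]
    rw [smul_pow]

/-- This is the homogeneous factor left in the Laplacian of a block; degree `k` keeps its
derivatives up to order `k` bounded near `0`. -/
lemma isHomogeneousOffZero_inv_normSq_smul (k : ℕ) :
    IsHomogeneousOffZero k
      fun x : EuclideanSpace ℝ (Fin n) => (‖x‖ ^ 2)⁻¹ • zCoord hn x ^ (k + 2) where
  smooth := ((contDiff_norm_sq ℝ).contDiffOn.inv fun x hx => by simpa using hx).smul
    (isHomogeneousOffZero_zCoord_pow hn _).smooth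
  homog c hc x := by
    simp only [(isHomogeneousOffZero_zCoord_pow hn (k + 2)).homog c hc x, norm_smul, smul_smul,
      Real.norm_of_nonneg hc.le]
    congr 1
    field_simp
    ring

lemma fderiv_fderiv_comp_negLogSq_smul_zCoord (k : ℕ) {h : ℝ → ℝ} (hh : ContDiff ℝ 2 h)
    {x : EuclideanSpace ℝ (Fin n)} (hx : x ≠ 0) (v : EuclideanSpace ℝ (Fin n)) :
    fderiv ℝ (fderiv ℝ fun y => h (negLogSq y) • zCoord hn y ^ (k + 2)) x v v =
      (deriv (deriv h) (negLogSq x) * (4 * (inner ℝ x v) ^ 2 / (‖x‖ ^ 2) ^ 2)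
        + deriv h (negLogSq x) * (4 * (inner ℝ x v) ^ 2 / (‖x‖ ^ 2) ^ 2 - 2 * ‖v‖ ^ 2 / ‖x‖ ^ 2))
          • zCoord hn x ^ (k + 2)
      - (deriv h (negLogSq x) * 4 * (k + 2) / ‖x‖ ^ 2) •
          (zCoord hn x ^ (k + 1) * ((inner ℝ x v) • zCoord hn v))
      + h (negLogSq x) • ((k + 2) * (k + 1) * zCoord hn x ^ k * zCoord hn v ^ 2) := by
  have hdh : Differentiable ℝ h := hh.differentiable two_ne_zero
  have hh1 : ContDiff ℝ 1 (deriv h) := by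
    have : ContDiff ℝ (1 + 1) h := hh.of_le (by norm_num)
    exact (contDiff_succ_iff_deriv.1 this).2.2
  have hddh : Differentiable ℝ (deriv h) := hh1.differentiable one_ne_zero
  have hU : {0}ᶜ ∈ 𝓝 x := isOpen_compl_singleton.mem_nhds hx
  have hC2 : ContDiffAt ℝ 2 (fun y => h (negLogSq y) • zCoord hn y ^ (k + 2)) x := by
    have := contDiffOn_comp_negLogSq_smul (N := 2)
      (isHomogeneousOffZero_zCoord_pow hn (k + 2)).smooth (h := h) (by exact_mod_cast hh)
    exact_mod_cast this.contDiffAt hU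
  have hline : ∀ τ : ℝ, HasDerivAt (fun τ : ℝ => x + τ • v) v τ := fun τ => by
    simpa using ((hasDerivAt_id τ).smul_const v).const_add x
  have hsq : ∀ τ : ℝ, HasDerivAt (fun τ : ℝ => ‖x + τ • v‖ ^ 2) (2 * inner ℝ (x + τ • v) v) τ :=
    fun τ => (hline τ).norm_sq
  have hq : ∀ τ : ℝ, HasDerivAt (fun τ : ℝ => inner ℝ (x + τ • v) v) (‖v‖ ^ 2) τ := fun τ => by
    have := (hline τ).inner ℝ (hasDerivAt_const τ v)
    simpa using this
  have hL : ∀ τ : ℝ, x + τ • v ≠ 0 → HasDerivAt (fun τ : ℝ => negLogSq (x + τ • v))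
      (-(2 * inner ℝ (x + τ • v) v / ‖x + τ • v‖ ^ 2)) τ := fun τ hτ =>
    ((hsq τ).log (by simpa using hτ)).neg
  have hz : ∀ τ : ℝ, HasDerivAt (fun τ : ℝ => zCoord hn (x + τ • v)) (zCoord hn v) τ := fun τ => by
    simp only [← zCoordCLM_apply]
    exact (zCoordCLM hn).hasFDerivAt.comp_hasDerivAt τ (hline τ)
  have hhL : ∀ τ : ℝ, x + τ • v ≠ 0 → HasDerivAt (fun τ : ℝ => h (negLogSq (x + τ • v)))
      (deriv h (negLogSq (x + τ • v)) * -(2 * inner ℝ (x + τ • v) v / ‖x + τ • v‖ ^ 2)) τ :=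
    fun τ hτ => (hdh _).hasDerivAt.comp τ (hL τ hτ)
  have hx0 : x + (0 : ℝ) • v ≠ 0 := by simpa using hx
  have hdhL := (hddh _).hasDerivAt.comp 0 (hL 0 hx0)
  have hev : ∀ᶠ τ in 𝓝 (0 : ℝ), x + τ • v ≠ 0 :=
    (hline 0).continuousAt.eventually_ne hx0
  have hx2 : ‖x + (0 : ℝ) • v‖ ^ 2 ≠ 0 := by simpa using hx
  refine fderiv_fderiv_apply_eq_of_hasDerivAt hC2 (g := fun τ => h (negLogSq (x + τ • v)) •
      (((k + 2 : ℕ) : ℂ) * zCoord hn (x + τ • v) ^ (k + 1) * zCoord hn v) +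
      (deriv h (negLogSq (x + τ • v)) * -(2 * inner ℝ (x + τ • v) v / ‖x + τ • v‖ ^ 2)) •
        zCoord hn (x + τ • v) ^ (k + 2)) ?_ ?_
  · filter_upwards [hev] with τ hτ
    exact (hhL τ hτ).smul ((hz τ).pow (k + 2))
  · have h1 := (hhL 0 hx0).smul ((((hz 0).pow (k + 1)).const_mul ((k + 2 : ℕ) : ℂ)).mul_const
      (zCoord hn v))
    have h2 := (hdhL.mul ((((hq 0).const_mul 2).div (hsq 0) hx2).neg)).smul ((hz 0).pow (k + 2))
    refine (h1.add h2).congr_deriv ?_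
    have hxn : (‖x‖ : ℂ) ≠ 0 := by exact_mod_cast norm_ne_zero_iff.2 hx
    simp only [zero_smul, add_zero, Complex.real_smul, Function.comp_apply, Pi.div_apply,
      Pi.neg_apply, Pi.mul_apply, Pi.pow_apply]
    push_cast
    field_simp
    ring

/-- The Laplacian of `h(-ln |x|²) z^{k+2}`. Since `z^{k+2}` is harmonic, it involves only the
derivatives of `h`. -/
lemma laplacian_comp_negLogSq_smul_zCoord (k : ℕ) {h : ℝ → ℝ} (hh : ContDiff ℝ 2 h)
    {x : EuclideanSpace ℝ (Fin n)} (hx : x ≠ 0) :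
    (Δ fun y => h (negLogSq y) • zCoord hn y ^ (k + 2)) x =
      (4 * deriv (deriv h) (negLogSq x) + (4 - 2 * n - 4 * (k + 2)) * deriv h (negLogSq x)) •
        ((‖x‖ ^ 2)⁻¹ • zCoord hn x ^ (k + 2)) := by
  have hxn : (‖x‖ : ℂ) ≠ 0 := by exact_mod_cast norm_ne_zero_iff.2 hx
  rw [laplacian_apply_eq_sum (EuclideanSpace.basisFun (Fin n) ℝ)]
  simp only [fderiv_fderiv_comp_negLogSq_smul_zCoord hn k hh hx]
  rw [Finset.sum_add_distrib, Finset.sum_sub_distrib, ← Finset.sum_smul, ← Finset.smul_sum,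
    ← Finset.smul_sum, ← Finset.mul_sum, ← Finset.mul_sum, sum_zCoord_basis_sq,
    sum_inner_smul_zCoord_basis, Finset.sum_add_distrib, ← Finset.mul_sum, ← Finset.mul_sum,
    Finset.sum_sub_distrib, ← Finset.sum_div, ← Finset.mul_sum,
    (EuclideanSpace.basisFun (Fin n) ℝ).sum_sq_inner_left]
  simp only [OrthonormalBasis.norm_eq_one, one_pow, mul_one, Finset.sum_const, Finset.card_univ,
    Fintype.card_fin, nsmul_eq_mul, Complex.real_smul]
  push_cast
  field_simp
  ring

end Coordinate

/-! ### Regularity, Laplacian bound and size of a block. -/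

section Block

variable {n : ℕ} (hn : 2 ≤ n)

lemma negLogSq_pos {x : EuclideanSpace ℝ (Fin n)} (hx0 : 0 < ‖x‖) (hx1 : ‖x‖ < 1) :
    0 < negLogSq x :=
  neg_pos.2 (Real.log_neg (by positivity) (pow_lt_one₀ hx0.le hx1 two_ne_zero))

lemma negLogSq_nonpos {x : EuclideanSpace ℝ (Fin n)} (hx : 1 ≤ ‖x‖) : negLogSq x ≤ 0 :=
  neg_nonpos.2 (Real.log_nonneg (one_le_pow₀ hx))

lemma exp_mul_negLogSq {x : EuclideanSpace ℝ (Fin n)} (hx : 0 < ‖x‖) (a : ℝ) :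
    Real.exp (-a * negLogSq x) = ‖x‖ ^ (2 * a) := by
  rw [Real.rpow_def_of_pos hx, negLogSq, Real.log_pow]
  congr 1
  push_cast
  ring

/-- The function `e^{-ts} ψ(s) z^{k+2}` at `s = -ln |x|²`. -/
noncomputable def profileBlock (k : ℕ) (ψ : ℝ → ℝ) (t : ℝ) (x : EuclideanSpace ℝ (Fin n)) : ℂ :=
  damped ψ t (negLogSq x) • zCoord hn x ^ (k + 2)

lemma buildingBlock_eq_profileBlock (k : ℕ) (φ : ℝ → ℝ) (t : ℝ) :
    buildingBlock hn k φ radialCutoff t = profileBlock hn k (cutProfile φ) t := by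
  ext x
  unfold buildingBlock profileBlock damped
  split_ifs with hx
  · rw [cutProfile, if_pos (negLogSq_pos hx.1 hx.2), exp_mul_negLogSq hx.1,
      show -negLogSq x / 2 = -(1 / 2) * negLogSq x by ring, exp_mul_negLogSq hx.1,
      show (2 : ℝ) * (1 / 2) = 1 by norm_num, Real.rpow_one, Complex.real_smul, negLogSq]
    push_cast
    ring
  · have h0 : cutProfile φ (negLogSq x) = 0 := by
      refine cutProfile_of_lt ?_
      rcases (norm_nonneg x).eq_or_lt with h | h
      -- At the origin `Real.log 0 = 0` gives `negLogSq 0 = 0`, where the cut profile vanishes.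
      · simp [negLogSq, ← h]
      · have := negLogSq_nonpos (not_lt.1 fun h' => hx ⟨h, h'⟩)
        linarith
    rw [h0, mul_zero, zero_smul]

variable {hn} {k : ℕ} {M : ℝ} {ψ : ℝ → ℝ} {t : ℝ}

lemma IsProfile.profileBlock_eq_zero {m : ℕ} (h : IsProfile m M ψ)
    {x : EuclideanSpace ℝ (Fin n)} (hx : 1 ≤ ‖x‖) : profileBlock hn k ψ t x = 0 := by
  rw [profileBlock, damped, h.eq_zero _ (by linarith [negLogSq_nonpos hx]), mul_zero, zero_smul]

lemma tendsto_negLogSq : Tendsto (negLogSq : EuclideanSpace ℝ (Fin n) → ℝ) (𝓝[≠] 0) atTop := by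
  refine tendsto_neg_atBot_atTop.comp (Real.tendsto_log_nhdsGT_zero.comp ?_)
  refine tendsto_nhdsWithin_iff.2 ⟨?_, ?_⟩
  · have h : Continuous fun x : EuclideanSpace ℝ (Fin n) => ‖x‖ ^ 2 := by fun_prop
    exact (h.tendsto' 0 0 (by simp)).mono_left nhdsWithin_le_nhds
  · filter_upwards [self_mem_nhdsWithin] with x hx
    have : 0 < ‖x‖ := norm_pos_iff.2 hx
    exact mem_Ioi.2 (by positivity)

/-- The block is `C^{k+2}` and all its derivatives of order at most `k + 2` vanish at `0`. -/
lemma IsProfile.contDiff_profileBlock (h : IsProfile (k + 2) M ψ) (hM : 0 ≤ M) (ht : 0 < t)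
    (ht1 : t ≤ 1) : ContDiff ℝ (k + 2 : ℕ) (profileBlock hn k ψ t) ∧
      ∀ j ≤ k + 2, iteratedFDeriv ℝ j (profileBlock hn k ψ t) 0 = 0 := by
  have hz := isHomogeneousOffZero_zCoord_pow hn (k + 2)
  obtain ⟨C, hC0, hC⟩ := hz.exists_bound (k + 2)
  refine contDiff_of_isLittleO (k + 2)
    (contDiffOn_comp_negLogSq_smul hz.smooth (h.contDiff_damped t)) ?_ fun j hj => ?_
  · simp [profileBlock, ← zCoordCLM_apply]
  · set b : EuclideanSpace ℝ (Fin n) → ℝ := fun x =>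
      C * ∑ i ∈ Finset.range (k + 2 + 1), |iteratedDeriv i (damped ψ t) (negLogSq x)| with hb
    have hblim : Tendsto b (𝓝[≠] 0) (𝓝 0) := by
      have h1 : Tendsto (fun s => C * ∑ i ∈ Finset.range (k + 2 + 1),
          |iteratedDeriv i (damped ψ t) s|) atTop (𝓝 0) := by
        have h2 := (tendsto_finsetSum (Finset.range (k + 2 + 1)) (fun i hi =>
          (h.tendsto_iteratedDeriv_damped hM (by omega) (i := i)
            (by simpa [Nat.lt_succ_iff] using hi) ht ht1).abs)).const_mul C
        simpa using h2
      exact h1.comp tendsto_negLogSq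
    have hbd : ∀ x : EuclideanSpace ℝ (Fin n), x ≠ 0 →
        ‖iteratedFDeriv ℝ j (profileBlock hn k ψ t) x‖ ≤ b x * ‖x‖ ^ (k + 2 - j) := by
      intro x hx
      have hx0 : ‖x‖ ≠ 0 := norm_ne_zero_iff.2 hx
      refine (hC _ (h.contDiff_damped t) _ x hx (fun i hi => Finset.single_le_sum
        (f := fun i => |iteratedDeriv i (damped ψ t) (negLogSq x)|)
        (fun _ _ => abs_nonneg _) (Finset.mem_range.2 (by omega : i < k + 2 + 1))) j hj).trans_eq ?_
      rw [inv_pow, ← pow_sub₀ _ hx0 hj]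
    refine Asymptotics.isLittleO_iff.2 fun c hc => ?_
    filter_upwards [self_mem_nhdsWithin, hblim.eventually (gt_mem_nhds hc)] with x hx hxc
    rw [norm_pow, norm_norm]
    exact (hbd x hx).trans (mul_le_mul_of_nonneg_right hxc.le (by positivity))

lemma iteratedFDeriv_eq_zero_of_one_lt_norm {F : Type*} [NormedAddCommGroup F] [NormedSpace ℝ F]
    {f : EuclideanSpace ℝ (Fin n) → F} (hf : ∀ x, 1 < ‖x‖ → f x = 0) (j : ℕ)
    {x : EuclideanSpace ℝ (Fin n)} (hx : 1 < ‖x‖) : iteratedFDeriv ℝ j f x = 0 := by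
  have h1 : f =ᶠ[𝓝 x] fun _ => 0 := by
    filter_upwards [continuous_norm.continuousAt.eventually (lt_mem_nhds hx)] with y hy
      using hf y hy
  rw [(h1.iteratedFDeriv ℝ j).eq_of_nhds]
  simp

/-- The derivatives of the Laplacian of the block are bounded uniformly in `t`. -/
lemma exists_bound_laplacian_profileBlock (hn : 2 ≤ n) (k : ℕ) {ψ : ℝ → ℝ}
    (h : IsProfile (k + 2) M ψ) (hM : 0 ≤ M) :
    ∃ C, ∀ t, 0 < t → t ≤ 1 → ∀ j ≤ k, ∀ x,
      ‖iteratedFDeriv ℝ j (Δ (profileBlock hn k ψ t)) x‖ ≤ C := by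
  obtain ⟨C, hC0, hC⟩ := (isHomogeneousOffZero_inv_normSq_smul hn k).exists_bound k
  set q : ℝ := 4 - 2 * n - 4 * (k + 2) with hq
  set B : ℝ := 4 * (2 ^ (k + 2) * M) + |q| * (2 ^ (k + 2) * M) with hB
  have hB0 : 0 ≤ B := by positivity
  refine ⟨C * B, fun t ht ht1 j hj => ?_⟩
  have hblock := (h.contDiff_profileBlock (hn := hn) hM ht ht1).1
  have hd : ContDiff ℝ (k + 2 : ℕ) (damped ψ t) := h.contDiff_damped t
  have hd1 : ContDiff ℝ (k + 1 : ℕ) (deriv (damped ψ t)) :=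
    (contDiff_succ_iff_deriv.1 (by exact_mod_cast hd)).2.2
  have hd2 : ContDiff ℝ (k : ℕ) (deriv (deriv (damped ψ t))) :=
    (contDiff_succ_iff_deriv.1 (by exact_mod_cast hd1)).2.2
  have hd1' : ContDiff ℝ (k : ℕ) (deriv (damped ψ t)) := hd1.of_le (by norm_cast; omega)
  -- The Laplacian is `H(-ln |x|²) |x|⁻² z^{k+2}`. No undifferentiated `damped ψ t` enters `H`, so
  -- the uniform bound applies.
  set H : ℝ → ℝ := fun s => 4 * deriv (deriv (damped ψ t)) s + q * deriv (damped ψ t) s with hH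
  have hHc : ContDiff ℝ k H := (contDiff_const.mul hd2).add (contDiff_const.mul hd1')
  have hHb : ∀ i ≤ k, ∀ s, |iteratedDeriv i H s| ≤ B := by
    intro i hi s
    have hi' : ((i : ℕ) : WithTop ℕ∞) ≤ (k : ℕ) := by exact_mod_cast hi
    have h1 : iteratedDeriv i H s = 4 * iteratedDeriv (i + 2) (damped ψ t) s
        + q * iteratedDeriv (i + 1) (damped ψ t) s := by
      rw [hH, iteratedDeriv_fun_add
        (((contDiff_const.mul hd2).of_le hi').contDiffAt)
        (((contDiff_const.mul hd1').of_le hi').contDiffAt),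
        iteratedDeriv_const_mul_field, iteratedDeriv_const_mul_field, iteratedDeriv_succ',
        iteratedDeriv_succ', iteratedDeriv_succ']
    have h2 := h.abs_iteratedDeriv_damped_le_const hM (by omega) (i := i + 2) (by omega)
      (by omega) ht ht1 s
    have h3 := h.abs_iteratedDeriv_damped_le_const hM (by omega) (i := i + 1) (by omega)
      (by omega) ht ht1 s
    have h4 : (2 : ℝ) ^ (i + 2) * M ≤ 2 ^ (k + 2) * M := by
      gcongr
      · norm_num
    have h5 : (2 : ℝ) ^ (i + 1) * M ≤ 2 ^ (k + 2) * M := by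
      refine mul_le_mul_of_nonneg_right (pow_le_pow_right₀ (by norm_num) (by omega)) hM
    rw [h1]
    refine (abs_add_le _ _).trans ?_
    rw [abs_mul, abs_mul, abs_of_pos (by norm_num : (0 : ℝ) < 4)]
    exact add_le_add (mul_le_mul_of_nonneg_left (h2.trans h4) (by norm_num))
      (mul_le_mul_of_nonneg_left (h3.trans h5) (abs_nonneg _))
  have hne : ∀ x : EuclideanSpace ℝ (Fin n), x ≠ 0 →
      ‖iteratedFDeriv ℝ j (Δ (profileBlock hn k ψ t)) x‖ ≤ C * B := by
    intro x hx
    rcases le_or_gt ‖x‖ 1 with hx1 | hx1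
    · have heq : Δ (profileBlock hn k ψ t) =ᶠ[𝓝 x]
          fun y => H (negLogSq y) • ((‖y‖ ^ 2)⁻¹ • zCoord hn y ^ (k + 2)) := by
        filter_upwards [isOpen_compl_singleton.mem_nhds hx] with y hy
        exact laplacian_comp_negLogSq_smul_zCoord hn k (hd.of_le (by norm_cast; omega)) hy
      rw [(heq.iteratedFDeriv ℝ j).eq_of_nhds]
      refine (hC H hHc B x hx (fun i hi => hHb i hi _) j hj).trans ?_
      rw [inv_pow, ← pow_sub₀ _ (norm_ne_zero_iff.2 hx) hj]
      exact mul_le_of_le_one_right (by positivity) (pow_le_one₀ (norm_nonneg x) hx1)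
    · rw [iteratedFDeriv_eq_zero_of_one_lt_norm (fun y hy => ?_) j hx1, norm_zero]
      · positivity
      · have h1 : profileBlock hn k ψ t =ᶠ[𝓝 y] fun _ => 0 := by
          filter_upwards [continuous_norm.continuousAt.eventually (lt_mem_nhds hy)] with z hz
            using h.profileBlock_eq_zero hz.le
        rw [InnerProductSpace.laplacian_congr_nhds h1 |>.eq_of_nhds]
        simp
  -- The bound extends to the origin by continuity; nonemptiness makes the space nontrivial, so that
  -- the punctured space is dense.
  have : Nonempty (Fin n) := ⟨⟨0, by omega⟩⟩
  have hcl : IsClosed {x | ‖iteratedFDeriv ℝ j (Δ (profileBlock hn k ψ t)) x‖ ≤ C * B} :=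
    isClosed_le (hblock.laplacian.continuous_iteratedFDeriv (by exact_mod_cast hj)).norm
      continuous_const
  intro x
  exact (dense_compl_singleton (0 : EuclideanSpace ℝ (Fin n))).induction (P := fun x =>
    ‖iteratedFDeriv ℝ j (Δ (profileBlock hn k ψ t)) x‖ ≤ C * B) (fun x hx => hne x hx) hcl x

/-- The real part of a block: what the gluing argument uses of it. -/
structure IsGluingBlock (k : ℕ) (C : ℝ) (w : EuclideanSpace ℝ (Fin n) → ℝ) : Prop where
  smooth : ContDiff ℝ (k + 2 : ℕ) w
  eq_zero : ∀ x, 1 ≤ ‖x‖ → w x = 0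
  iteratedFDeriv_zero : ∀ j ≤ k + 2, iteratedFDeriv ℝ j w 0 = 0
  laplacian_bound : ∀ j ≤ k, ∀ x, ‖iteratedFDeriv ℝ j (Δ w) x‖ ≤ C

lemma exists_isGluingBlock_re (hn : 2 ≤ n) (k : ℕ) {ψ : ℝ → ℝ} (h : IsProfile (k + 2) M ψ)
    (hM : 0 ≤ M) : ∃ C, ∀ t, 0 < t → t ≤ 1 →
      IsGluingBlock k C fun x => (profileBlock hn k ψ t x).re := by
  obtain ⟨C, hC⟩ := exists_bound_laplacian_profileBlock hn k h hM
  have hC0 : 0 ≤ C := (norm_nonneg _).trans (hC 1 one_pos le_rfl 0 (Nat.zero_le _) 0)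
  refine ⟨C, fun t ht ht1 => ?_⟩
  obtain ⟨hs, h0⟩ := h.contDiff_profileBlock (hn := hn) hM ht ht1
  have hre : (fun x => (profileBlock hn k ψ t x).re) = Complex.reCLM ∘ profileBlock hn k ψ t := rfl
  rw [hre]
  refine ⟨Complex.reCLM.contDiff.comp hs, fun x hx => ?_, fun j hj => ?_, fun j hj x => ?_⟩
  · simp [h.profileBlock_eq_zero hx]
  · have := Complex.reCLM.norm_iteratedFDeriv_comp_left (hs.contDiffAt (x := 0)) (n := j)
      (by exact_mod_cast hj)
    rw [h0 j hj, norm_zero, mul_zero] at this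
    exact norm_le_zero_iff.1 this
  · have hlap : Δ (Complex.reCLM ∘ profileBlock hn k ψ t) =
        Complex.reCLM ∘ Δ (profileBlock hn k ψ t) := by
      ext y
      exact (hs.of_le (by norm_cast; omega)).contDiffAt.laplacian_CLM_comp_left
    rw [hlap]
    refine (Complex.reCLM.norm_iteratedFDeriv_comp_left (hs.laplacian.contDiffAt (x := x)) (n := j)
      (by exact_mod_cast hj)).trans ?_
    simpa using hC t ht ht1 j hj x

/-- On the first coordinate axis the block is comparable with `φ(1/(2t)) |x|^{k+2}`. -/
lemma exists_re_profileBlock_cutProfile (hn : 2 ≤ n) (k : ℕ) (φ : ℝ → ℝ) {t : ℝ} (ht : 0 < t)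
    (ht1 : t < 1 / 4) : ∃ x : EuclideanSpace ℝ (Fin n), 0 < ‖x‖ ∧ ‖x‖ < 1 ∧
      (profileBlock hn k (cutProfile φ) t x).re =
        Real.exp (-1 / 2) * φ (1 / (2 * t)) * ‖x‖ ^ (k + 2) := by
  -- With `|x| = a` one has `s = 1/(2t)`, hence `ts = 1/2` and the damping factor is exactly
  -- `e^{-1/2}`.
  set a : ℝ := Real.exp (-(1 / (4 * t))) with ha
  have ha0 : 0 < a := Real.exp_pos _
  have hnorm : ‖a • EuclideanSpace.single (⟨0, by omega⟩ : Fin n) (1 : ℝ)‖ = a := by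
    simp [norm_smul, abs_of_pos ha0]
  have hz : zCoord hn (a • EuclideanSpace.single (⟨0, by omega⟩ : Fin n) (1 : ℝ)) = a := by
    apply Complex.ext <;> simp [zCoord]
  have hL : negLogSq (a • EuclideanSpace.single (⟨0, by omega⟩ : Fin n) (1 : ℝ)) = 1 / (2 * t) := by
    rw [negLogSq, hnorm, Real.log_pow, ha, Real.log_exp]
    field_simp
    norm_num
  refine ⟨a • EuclideanSpace.single ⟨0, by omega⟩ 1, by rwa [hnorm], ?_, ?_⟩
  · rw [hnorm]
    rw [ha, Real.exp_lt_one_iff]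
    exact neg_neg_of_pos (by positivity)
  · have h2 : 2 ≤ 1 / (2 * t) := by
      rw [le_div_iff₀ (by positivity)]
      linarith
    rw [profileBlock, hL, hnorm, hz, damped, cutProfile_of_two_le h2, ← Complex.ofReal_pow,
      Complex.real_smul, ← Complex.ofReal_mul, Complex.ofReal_re]
    congr 3
    field_simp

end Block

/-! ### Gluing rescaled blocks along a ray. -/

section Gluing

variable {n : ℕ}

lemma one_le_norm_zetaZero (hn : 2 ≤ n) : 1 ≤ ‖zetaZero n‖ := by
  have h : ‖zetaZero n‖ ^ 2 = n * (1 / 2) := by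
    rw [EuclideanSpace.norm_sq_eq]
    simp [zetaZero]
  have h2 : (2 : ℝ) ≤ n := by exact_mod_cast hn
  nlinarith [norm_nonneg (zetaZero n)]

/-- The rescaled and translated block `ε r^{k+2} w((x - R ζ₀) / r)`. -/
noncomputable def gluedTerm (k : ℕ) (ε R r : ℝ) (w : EuclideanSpace ℝ (Fin n) → ℝ)
    (x : EuclideanSpace ℝ (Fin n)) : ℝ :=
  (ε * r ^ (k + 2)) * w (r⁻¹ • (x - R • zetaZero n))

lemma contDiff_gluedTerm {k m : ℕ} {w : EuclideanSpace ℝ (Fin n) → ℝ} (hw : ContDiff ℝ m w)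
    (ε R r : ℝ) : ContDiff ℝ m (gluedTerm k ε R r w) :=
  contDiff_const.mul (hw.comp (by fun_prop))

lemma norm_iteratedFDeriv_const_mul_affine {m j : ℕ} {w : EuclideanSpace ℝ (Fin n) → ℝ}
    (hw : ContDiff ℝ m w) (hj : j ≤ m) {c r : ℝ} (hc : 0 ≤ c) (hr : 0 ≤ r)
    (a x : EuclideanSpace ℝ (Fin n)) :
    ‖iteratedFDeriv ℝ j (fun x => c * w (r⁻¹ • (x - a))) x‖ =
      c * r⁻¹ ^ j * ‖iteratedFDeriv ℝ j w (r⁻¹ • (x - a))‖ := by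
  have hcd : ContDiff ℝ j fun x => w (r⁻¹ • (x - a)) :=
    (hw.of_le (by exact_mod_cast hj)).comp (by fun_prop)
  have h1 : (fun x => c * w (r⁻¹ • (x - a))) = c • fun x => w (r⁻¹ • (x - a)) := rfl
  rw [h1, iteratedFDeriv_const_smul_apply hcd.contDiffAt, norm_smul, Real.norm_of_nonneg hc,
    norm_iteratedFDeriv_comp_affine (inv_nonneg.2 hr), mul_assoc]

lemma pow_mul_inv_pow_le {r : ℝ} (hr : 0 < r) (hr1 : r ≤ 1) {a j : ℕ} (h : j + 1 ≤ a) :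
    r ^ a * r⁻¹ ^ j ≤ r := by
  rw [inv_pow, ← pow_sub₀ _ hr.ne' (by omega)]
  exact pow_le_of_le_one hr.le hr1 (by omega)

/-- Summability and separation hypotheses on the blocks of a glued sum. -/
structure IsGluable (k : ℕ) (C : ℝ) (ε R r : ℕ → ℝ)
    (w : ℕ → EuclideanSpace ℝ (Fin n) → ℝ) : Prop where
  block : ∀ l, IsGluingBlock k C (w l)
  ε_pos : ∀ l, 0 < ε l
  ε_le : ∀ l, ε l ≤ (1 / 2) ^ l
  r_pos : ∀ l, 0 < r l
  r_le_one : ∀ l, r l ≤ 1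
  r_le : ∀ l, 4 * r l ≤ R l
  r_anti : Antitone r
  R_anti : Antitone R
  R_lim : Tendsto R atTop (𝓝 0)
  separated : ∀ l m, l < m → R m + r m < R l - r l
  small : ∀ l, ∀ j ≤ k + 1, ∀ x, r l * ‖iteratedFDeriv ℝ j (w l) x‖ ≤ (1 / 2) ^ l * R l ^ 2

namespace IsGluable

variable {k : ℕ} {C : ℝ} {ε R r : ℕ → ℝ} {w : ℕ → EuclideanSpace ℝ (Fin n) → ℝ}

lemma R_pos (h : IsGluable k C ε R r w) (l : ℕ) : 0 < R l := by
  linarith [h.r_le l, h.r_pos l]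

lemma ε_le_one (h : IsGluable k C ε R r w) (l : ℕ) : ε l ≤ 1 :=
  (h.ε_le l).trans (pow_le_one₀ (by norm_num) (by norm_num))

lemma gluedTerm_eq_zero (h : IsGluable k C ε R r w) {l : ℕ} {x : EuclideanSpace ℝ (Fin n)}
    (hx : r l ≤ ‖x - R l • zetaZero n‖) : gluedTerm k (ε l) (R l) (r l) (w l) x = 0 := by
  rw [gluedTerm, (h.block l).eq_zero, mul_zero]
  rw [norm_smul, norm_inv, Real.norm_of_nonneg (h.r_pos l).le, inv_mul_eq_div,
    one_le_div (h.r_pos l)]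
  exact hx

lemma gluedTerm_eq_zero_of_norm (h : IsGluable k C ε R r w) {l : ℕ}
    {x : EuclideanSpace ℝ (Fin n)} (hx : R l * ‖zetaZero n‖ + r l ≤ ‖x‖) :
    gluedTerm k (ε l) (R l) (r l) (w l) x = 0 := by
  refine h.gluedTerm_eq_zero ?_
  have h1 := norm_sub_norm_le x (R l • zetaZero n)
  rw [norm_smul, Real.norm_of_nonneg (h.R_pos l).le] at h1
  linarith

lemma norm_iteratedFDeriv_gluedTerm (h : IsGluable k C ε R r w) (l : ℕ) {j : ℕ} (hj : j ≤ k + 2)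
    (x : EuclideanSpace ℝ (Fin n)) :
    ‖iteratedFDeriv ℝ j (gluedTerm k (ε l) (R l) (r l) (w l)) x‖ =
      ε l * r l ^ (k + 2) * (r l)⁻¹ ^ j *
        ‖iteratedFDeriv ℝ j (w l) ((r l)⁻¹ • (x - R l • zetaZero n))‖ :=
  norm_iteratedFDeriv_const_mul_affine (h.block l).smooth hj
    (mul_nonneg (h.ε_pos l).le (pow_nonneg (h.r_pos l).le _)) (h.r_pos l).le _ x

/-- At order at most `k + 1` a factor `r l` survives the rescaling, and `small` applies to it. -/
lemma norm_iteratedFDeriv_gluedTerm_le (h : IsGluable k C ε R r w) (l : ℕ) {j : ℕ}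
    (hj : j ≤ k + 1) (x : EuclideanSpace ℝ (Fin n)) :
    ‖iteratedFDeriv ℝ j (gluedTerm k (ε l) (R l) (r l) (w l)) x‖ ≤ (1 / 2) ^ l * R l ^ 2 := by
  rw [h.norm_iteratedFDeriv_gluedTerm l (by omega)]
  have h1 := pow_mul_inv_pow_le (h.r_pos l) (h.r_le_one l) (a := k + 2) (j := j) (by omega)
  have h2 : 0 ≤ r l ^ (k + 2) * (r l)⁻¹ ^ j := by
    have := h.r_pos l
    positivity
  refine le_trans ?_ (h.small l j hj ((r l)⁻¹ • (x - R l • zetaZero n)))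
  refine mul_le_mul_of_nonneg_right ?_ (norm_nonneg _)
  rw [mul_assoc]
  exact (mul_le_of_le_one_left h2 (h.ε_le_one l)).trans h1

/-- Since the `l`-th term lives at distance about `R l` from the origin, its derivatives of order
at most `k + 1` are quadratically small there. -/
lemma norm_iteratedFDeriv_gluedTerm_le_sq (h : IsGluable k C ε R r w) (hn : 2 ≤ n) (l : ℕ) {j : ℕ}
    (hj : j ≤ k + 1) (x : EuclideanSpace ℝ (Fin n)) :
    ‖iteratedFDeriv ℝ j (gluedTerm k (ε l) (R l) (r l) (w l)) x‖ ≤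
      (1 / 2) ^ l * (4 * ‖x‖ ^ 2) := by
  rcases le_or_gt ‖x - R l • zetaZero n‖ (r l) with hx | hx
  · refine (h.norm_iteratedFDeriv_gluedTerm_le l hj x).trans ?_
    have h1 : R l * ‖zetaZero n‖ ≤ ‖x‖ + r l := by
      have h2 := norm_sub_norm_le (R l • zetaZero n) x
      rw [norm_smul, Real.norm_of_nonneg (h.R_pos l).le, norm_sub_rev] at h2
      linarith
    have h3 : R l ≤ R l * ‖zetaZero n‖ :=
      le_mul_of_one_le_right (h.R_pos l).le (one_le_norm_zetaZero hn)
    -- On the ball, `R ≤ ‖x‖ + r ≤ ‖x‖ + R/4`.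
    have h4 : R l ≤ 2 * ‖x‖ := by linarith [h.r_le l, h.R_pos l]
    have h5 : R l ^ 2 ≤ (2 * ‖x‖) ^ 2 := pow_le_pow_left₀ (h.R_pos l).le h4 2
    have h6 : (2 * ‖x‖) ^ 2 = 4 * ‖x‖ ^ 2 := by ring
    rw [← h6]
    gcongr
  · have h1 : gluedTerm k (ε l) (R l) (r l) (w l) =ᶠ[𝓝 x] fun _ => 0 := by
      have hc : Continuous fun y => ‖y - R l • zetaZero n‖ := by fun_prop
      filter_upwards [hc.continuousAt.eventually (lt_mem_nhds hx)] with y hy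
        using h.gluedTerm_eq_zero (le_of_lt hy)
    rw [(h1.iteratedFDeriv ℝ j).eq_of_nhds]
    have h2 : iteratedFDeriv ℝ j (fun _ : EuclideanSpace ℝ (Fin n) => (0 : ℝ)) x = 0 := by simp
    rw [h2, norm_zero]
    positivity

lemma summable_bound (h : IsGluable k C ε R r w) :
    Summable fun l => (1 / 2 : ℝ) ^ l * R l ^ 2 := by
  refine Summable.of_nonneg_of_le (fun l => by positivity) (fun l => ?_)
    (summable_geometric_two.mul_right (R 0 ^ 2))
  exact mul_le_mul_of_nonneg_left
    (pow_le_pow_left₀ (h.R_pos l).le (h.R_anti (Nat.zero_le l)) 2) (by positivity)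

/-- The sum of the rescaled blocks. -/
noncomputable def sum (_ : IsGluable k C ε R r w) (x : EuclideanSpace ℝ (Fin n)) : ℝ :=
  ∑' l, gluedTerm k (ε l) (R l) (r l) (w l) x

lemma iteratedFDeriv_sum (h : IsGluable k C ε R r w) {j : ℕ} (hj : j ≤ k + 1)
    (x : EuclideanSpace ℝ (Fin n)) :
    iteratedFDeriv ℝ j h.sum x =
      ∑' l, iteratedFDeriv ℝ j (gluedTerm k (ε l) (R l) (r l) (w l)) x :=
  iteratedFDeriv_tsum_apply (N := (k + 1 : ℕ)) (v := fun _ l => (1 / 2 : ℝ) ^ l * R l ^ 2)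
    (fun l => contDiff_gluedTerm ((h.block l).smooth.of_le (by norm_cast; omega)) _ _ _)
    (fun _ _ => h.summable_bound)
    (fun j l x hj => h.norm_iteratedFDeriv_gluedTerm_le l (by exact_mod_cast hj) x)
    (by exact_mod_cast hj) x

lemma summable_iteratedFDeriv (h : IsGluable k C ε R r w) {j : ℕ} (hj : j ≤ k + 1)
    (x : EuclideanSpace ℝ (Fin n)) :
    Summable fun l => iteratedFDeriv ℝ j (gluedTerm k (ε l) (R l) (r l) (w l)) x :=
  .of_norm_bounded h.summable_bound fun l => h.norm_iteratedFDeriv_gluedTerm_le l hj x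

lemma norm_iteratedFDeriv_sum_le (h : IsGluable k C ε R r w) (hn : 2 ≤ n) {j : ℕ}
    (hj : j ≤ k + 1) (x : EuclideanSpace ℝ (Fin n)) :
    ‖iteratedFDeriv ℝ j h.sum x‖ ≤ 8 * ‖x‖ ^ 2 := by
  rw [h.iteratedFDeriv_sum hj]
  have h1 : HasSum (fun l : ℕ => (1 / 2 : ℝ) ^ l * (4 * ‖x‖ ^ 2)) (2 * (4 * ‖x‖ ^ 2)) :=
    hasSum_geometric_two.mul_right _
  refine (tsum_of_norm_bounded h1 fun l =>
    h.norm_iteratedFDeriv_gluedTerm_le_sq hn l hj x).trans_eq ?_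
  ring

/-- Only finitely many terms are nonzero near a point other than the origin, since the balls shrink
to `0`. -/
lemma contDiffAt_sum (h : IsGluable k C ε R r w) {x : EuclideanSpace ℝ (Fin n)} (hx : x ≠ 0) :
    ContDiffAt ℝ (k + 2 : ℕ) h.sum x := by
  have hx0 : 0 < ‖x‖ := norm_pos_iff.2 hx
  have hlim : Tendsto (fun l => R l * ‖zetaZero n‖ + R l) atTop (𝓝 0) := by
    simpa using (h.R_lim.mul_const ‖zetaZero n‖).add h.R_lim
  obtain ⟨N, hN⟩ := eventually_atTop.1 (hlim.eventually (gt_mem_nhds (half_pos hx0)))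
  have heq : h.sum =ᶠ[𝓝 x]
      fun y => ∑ l ∈ Finset.range N, gluedTerm k (ε l) (R l) (r l) (w l) y := by
    filter_upwards [continuous_norm.continuousAt.eventually (lt_mem_nhds (half_lt_self hx0))]
      with y hy
    refine tsum_eq_sum fun l hl => h.gluedTerm_eq_zero_of_norm ?_
    have h1 := hN l (by simpa using hl)
    linarith [h.r_le l, h.r_pos l]
  refine ContDiffAt.congr_of_eventuallyEq ?_ heq
  exact ContDiffAt.sum fun l _ => (contDiff_gluedTerm (h.block l).smooth _ _ _).contDiffAt

lemma timesDifferentiable_sum (h : IsGluable k C ε R r w) (hn : 2 ≤ n) :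
    TimesDifferentiable (k + 2) h.sum := by
  intro j hj x
  rcases eq_or_ne x 0 with rfl | hx
  · have hb := h.norm_iteratedFDeriv_sum_le hn (j := j) (by omega)
    have h0 : iteratedFDeriv ℝ j h.sum 0 = 0 := by
      rw [← norm_le_zero_iff]
      simpa using hb 0
    -- The quadratic bound gives derivative `0` at the origin for every order `j ≤ k + 1`;
    -- continuity of the derivative of order `k + 2` is not needed.
    have hd : HasFDerivAt (iteratedFDeriv ℝ j h.sum) (0 : EuclideanSpace ℝ (Fin n) →L[ℝ] _) 0 := by
      refine HasFDerivAt.of_isLittleO ?_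
      simp only [h0, sub_zero, zero_apply]
      have h1 : (fun x => iteratedFDeriv ℝ j h.sum x) =O[𝓝 0]
          fun x : EuclideanSpace ℝ (Fin n) => ‖x‖ ^ 2 := by
        refine Asymptotics.IsBigO.of_bound 8 (Eventually.of_forall fun x => ?_)
        rw [norm_pow, norm_norm]
        exact hb x
      exact h1.trans_isLittleO (Asymptotics.isLittleO_norm_pow_id one_lt_two)
    exact hd.differentiableAt
  · exact (h.contDiffAt_sum hx).differentiableAt_iteratedFDeriv (by exact_mod_cast hj)

lemma hasCompactSupport_sum (h : IsGluable k C ε R r w) : HasCompactSupport h.sum := by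
  refine HasCompactSupport.intro
    (isCompact_closedBall (0 : EuclideanSpace ℝ (Fin n)) (R 0 * ‖zetaZero n‖ + r 0)) fun x hx => ?_
  rw [mem_closedBall_zero_iff, not_le] at hx
  have h0 : ∀ l, gluedTerm k (ε l) (R l) (r l) (w l) x = 0 := fun l => by
    refine h.gluedTerm_eq_zero_of_norm (le_trans ?_ hx.le)
    exact add_le_add (mul_le_mul_of_nonneg_right (h.R_anti (Nat.zero_le l)) (norm_nonneg _))
      (h.r_anti (Nat.zero_le l))
  simp [sum, h0]

lemma laplacian_gluedTerm (h : IsGluable k C ε R r w) (l : ℕ) :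
    Δ (gluedTerm k (ε l) (R l) (r l) (w l)) = fun x => (ε l * r l ^ k) *
      (Δ (w l)) ((r l)⁻¹ • (x - R l • zetaZero n)) := by
  ext x
  have h1 : gluedTerm k (ε l) (R l) (r l) (w l) =
      (ε l * r l ^ (k + 2)) • fun x => w l ((r l)⁻¹ • (x - R l • zetaZero n)) := rfl
  have h2 : ContDiff ℝ 2 fun x => w l ((r l)⁻¹ • (x - R l • zetaZero n)) :=
    ((h.block l).smooth.of_le (by norm_cast; omega)).comp (by fun_prop)
  rw [h1, InnerProductSpace.laplacian_smul _ h2.contDiffAt, laplacian_comp_affine]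
  have := (h.r_pos l).ne'
  simp only [smul_eq_mul]
  field_simp
  ring

/-- Here `r` gives no smallness when `j = k`; summability comes from `ε l` alone, which is why `C`
must not depend on `l`. -/
lemma norm_iteratedFDeriv_laplacian_gluedTerm_le (h : IsGluable k C ε R r w) (l : ℕ) {j : ℕ}
    (hj : j ≤ k) (x : EuclideanSpace ℝ (Fin n)) :
    ‖iteratedFDeriv ℝ j (Δ (gluedTerm k (ε l) (R l) (r l) (w l))) x‖ ≤ (1 / 2) ^ l * C := by
  have hr := h.r_pos l
  rw [h.laplacian_gluedTerm, norm_iteratedFDeriv_const_mul_affine (h.block l).smooth.laplacian hj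
    (mul_nonneg (h.ε_pos l).le (by positivity)) hr.le]
  have h1 : r l ^ k * (r l)⁻¹ ^ j ≤ 1 := by
    rw [inv_pow, ← pow_sub₀ _ hr.ne' hj]
    exact pow_le_one₀ hr.le (h.r_le_one l)
  refine mul_le_mul ?_ ((h.block l).laplacian_bound j hj _) (norm_nonneg _) (by positivity)
  rw [mul_assoc]
  exact (mul_le_of_le_one_right (h.ε_pos l).le h1).trans (h.ε_le l)

lemma laplacian_sum (h : IsGluable k C ε R r w) (hk : 1 ≤ k) :
    Δ h.sum = fun x => ∑' l, (Δ (gluedTerm k (ε l) (R l) (r l) (w l))) x := by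
  ext x
  set b := EuclideanSpace.basisFun (Fin n) ℝ with hb
  set Λ : (EuclideanSpace ℝ (Fin n) [×2]→L[ℝ] ℝ) →L[ℝ] ℝ :=
    ∑ i, ContinuousMultilinearMap.apply ℝ _ ℝ ![b i, b i] with hΛ
  have hlap : ∀ f : EuclideanSpace ℝ (Fin n) → ℝ, (Δ f) x = Λ (iteratedFDeriv ℝ 2 f x) := by
    intro f
    rw [InnerProductSpace.laplacian_eq_iteratedFDeriv_orthonormalBasis f b]
    simp [hΛ]
  simp only [hlap]
  -- Termwise differentiation is available up to order `k + 1`, so order `2` requires `1 ≤ k`.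
  rw [h.iteratedFDeriv_sum (by omega), Λ.map_tsum (h.summable_iteratedFDeriv (by omega) x)]

lemma contDiff_laplacian_sum (h : IsGluable k C ε R r w) (hk : 1 ≤ k) :
    ContDiff ℝ k (Δ h.sum) := by
  rw [h.laplacian_sum hk]
  exact contDiff_tsum (N := (k : ℕ)) (v := fun _ l => (1 / 2 : ℝ) ^ l * C)
    (fun l => (contDiff_gluedTerm (h.block l).smooth _ _ _).laplacian)
    (fun _ _ => summable_geometric_two.mul_right C)
    (fun j l x hj => h.norm_iteratedFDeriv_laplacian_gluedTerm_le l (by exact_mod_cast hj) x)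

/-- The balls carrying different terms are disjoint. -/
lemma le_norm_sub_of_ne (h : IsGluable k C ε R r w) (hn : 2 ≤ n) {l m : ℕ} (hm : m ≠ l)
    {x : EuclideanSpace ℝ (Fin n)} (hx : ‖x - R l • zetaZero n‖ < r l) :
    r m ≤ ‖x - R m • zetaZero n‖ := by
  have h1 : r l + r m ≤ |R l - R m| := by
    rcases lt_or_gt_of_ne hm with hlm | hlm
    · have := h.separated m l hlm
      rw [abs_sub_comm]
      exact le_trans (by linarith) (le_abs_self _)
    · have := h.separated l m hlm
      exact le_trans (by linarith) (le_abs_self _)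
  have h2 : |R l - R m| ≤ ‖R l • zetaZero n - R m • zetaZero n‖ := by
    rw [← sub_smul, norm_smul, Real.norm_eq_abs]
    exact le_mul_of_one_le_right (abs_nonneg _) (one_le_norm_zetaZero hn)
  have h3 := norm_sub_le_norm_sub_add_norm_sub (R l • zetaZero n) x (R m • zetaZero n)
  rw [norm_sub_rev _ x] at h3
  linarith

lemma sum_eq_gluedTerm (h : IsGluable k C ε R r w) (hn : 2 ≤ n) {l : ℕ}
    {x : EuclideanSpace ℝ (Fin n)} (hx : ‖x - R l • zetaZero n‖ < r l) :
    h.sum x = gluedTerm k (ε l) (R l) (r l) (w l) x :=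
  tsum_eq_single l fun _ hm => h.gluedTerm_eq_zero (h.le_norm_sub_of_ne hn hm hx)

/-- A bound for the top order derivative of the glued sum bounds that of each block. -/
lemma mul_norm_iteratedFDeriv_le (h : IsGluable k C ε R r w) (hn : 2 ≤ n) {A : ℝ}
    (hA : ∀ x, ‖iteratedFDeriv ℝ (k + 2) h.sum x‖ ≤ A) (l : ℕ) {y : EuclideanSpace ℝ (Fin n)}
    (hy : ‖y‖ < 1) : ε l * ‖iteratedFDeriv ℝ (k + 2) (w l) y‖ ≤ A := by
  have hr := h.r_pos l
  set x := R l • zetaZero n + r l • y with hx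
  have hxy : (r l)⁻¹ • (x - R l • zetaZero n) = y := by
    rw [hx, add_sub_cancel_left, smul_smul, inv_mul_cancel₀ hr.ne', one_smul]
  have hxr : ‖x - R l • zetaZero n‖ < r l := by
    rw [hx, add_sub_cancel_left, norm_smul, Real.norm_of_nonneg hr.le]
    exact mul_lt_of_lt_one_right hr hy
  have heq : h.sum =ᶠ[𝓝 x] gluedTerm k (ε l) (R l) (r l) (w l) := by
    have hc : Continuous fun y => ‖y - R l • zetaZero n‖ := by fun_prop
    filter_upwards [hc.continuousAt.eventually (gt_mem_nhds hxr)] with z hz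
      using h.sum_eq_gluedTerm hn hz
  have h1 := hA x
  rw [(heq.iteratedFDeriv ℝ (k + 2)).eq_of_nhds, h.norm_iteratedFDeriv_gluedTerm l le_rfl, hxy,
    mul_assoc (ε l), ← mul_pow, mul_inv_cancel₀ hr.ne', one_pow, mul_one] at h1
  exact h1

end IsGluable

/-- Iterated mean value inequality for a function whose derivatives of order less than `m` vanish at
the origin. -/
lemma norm_le_mul_pow_of_iteratedFDeriv_le {E : Type*} [NormedAddCommGroup E] [NormedSpace ℝ E]
    {f : E → ℝ} {m : ℕ} (hf : ContDiff ℝ m f) (h0 : ∀ j < m, iteratedFDeriv ℝ j f 0 = 0) {A : ℝ}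
    (hA : ∀ y, ‖y‖ < 1 → ‖iteratedFDeriv ℝ m f y‖ ≤ A) {y : E} (hy : ‖y‖ < 1) :
    ‖f y‖ ≤ A * ‖y‖ ^ m := by
  have hA0 : 0 ≤ A := (norm_nonneg _).trans (hA y hy)
  -- Each integration along a radius lowers the order by one and gains a factor `‖y‖`.
  have key : ∀ i ≤ m, ∀ y, ‖y‖ < 1 → ‖iteratedFDeriv ℝ (m - i) f y‖ ≤ A * ‖y‖ ^ i := by
    intro i
    induction i with
    | zero => simpa using hA
    | succ i ih =>
      intro hi y hy
      have hsucc : m - i = (m - (i + 1)) + 1 := by omega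
      have hd : Differentiable ℝ (iteratedFDeriv ℝ (m - (i + 1)) f) :=
        hf.differentiable_iteratedFDeriv (by norm_cast; omega)
      have h1 := (convex_closedBall (0 : E) ‖y‖).norm_image_sub_le_of_norm_fderiv_le (𝕜 := ℝ)
        (f := iteratedFDeriv ℝ (m - (i + 1)) f) (C := A * ‖y‖ ^ i) (x := 0) (y := y)
        (fun x _ => hd x) (fun x hx => ?_) (by simp) (by simp)
      · rw [h0 _ (by omega), sub_zero, sub_zero, mul_assoc, ← pow_succ] at h1
        exact h1
      · rw [mem_closedBall_zero_iff] at hx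
        rw [norm_fderiv_iteratedFDeriv, ← hsucc]
        exact (ih (by omega) x (hx.trans_lt hy)).trans (by gcongr)
  have h1 := key m le_rfl y hy
  rwa [Nat.sub_self, norm_iteratedFDeriv_zero] at h1

lemma IsGluable.not_bounded_iteratedFDeriv_sum {k : ℕ} {C : ℝ} {ε R r : ℕ → ℝ}
    {w : ℕ → EuclideanSpace ℝ (Fin n) → ℝ} (h : IsGluable k C ε R r w) (hn : 2 ≤ n)
    (hw : ∀ A : ℝ, ∃ l, ∃ y, ‖y‖ < 1 ∧ A * ‖y‖ ^ (k + 2) < ε l * ‖w l y‖) :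
    ¬ ∃ A : ℝ, ∀ x, ‖iteratedFDeriv ℝ (k + 2) h.sum x‖ ≤ A := by
  rintro ⟨A, hA⟩
  obtain ⟨l, y, hy, hlt⟩ := hw A
  have hε := h.ε_pos l
  have h1 := norm_le_mul_pow_of_iteratedFDeriv_le (h.block l).smooth
    (fun j hj => (h.block l).iteratedFDeriv_zero j hj.le) (A := A / ε l)
    (fun z hz => by
      rw [le_div_iff₀ hε, mul_comm]
      exact h.mul_norm_iteratedFDeriv_le hn hA l hz) hy
  have h2 : ε l * ‖w l y‖ ≤ ε l * (A / ε l * ‖y‖ ^ (k + 2)) :=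
    mul_le_mul_of_nonneg_left h1 hε.le
  rw [← mul_assoc, mul_div_cancel₀ _ hε.ne'] at h2
  linarith

end Gluing

/-! ### Choice of scales and exponents. -/

lemma IsGluingBlock.exists_bound {n k : ℕ} {C : ℝ} {w : EuclideanSpace ℝ (Fin n) → ℝ}
    (h : IsGluingBlock k C w) :
    ∃ K, 0 ≤ K ∧ ∀ j ≤ k + 1, ∀ x, ‖iteratedFDeriv ℝ j w x‖ ≤ K := by
  have hcs : HasCompactSupport w := HasCompactSupport.intro
    (isCompact_closedBall (0 : EuclideanSpace ℝ (Fin n)) 1) fun x hx => by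
      rw [mem_closedBall_zero_iff, not_le] at hx
      exact h.eq_zero x hx.le
  have key : ∀ j : ℕ, ∃ K, j ≤ k + 1 → ∀ x, ‖iteratedFDeriv ℝ j w x‖ ≤ K := by
    intro j
    by_cases hj : j ≤ k + 1
    · obtain ⟨K, hK⟩ := (h.smooth.continuous_iteratedFDeriv (m := j)
        (by norm_cast; omega)).bounded_above_of_compact_support (hcs.iteratedFDeriv j)
      exact ⟨K, fun _ => hK⟩
    · exact ⟨0, fun h => absurd h hj⟩
  choose K hK using key
  refine ⟨∑ j ∈ Finset.range (k + 2), |K j|, Finset.sum_nonneg fun _ _ => abs_nonneg _,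
    fun j hj x => ?_⟩
  exact ((hK j hj x).trans (le_abs_self _)).trans (Finset.single_le_sum (f := fun j => |K j|)
    (fun _ _ => abs_nonneg _) (Finset.mem_range.2 (by omega)))

/-- Scales that are small compared with the given bounds `K`. -/
noncomputable def gluingScale (K : ℕ → ℝ) (l : ℕ) : ℝ :=
  1 / 4 * (1 / 32) ^ l / (1 + ∑ i ∈ Finset.range (l + 1), K i)

section Scale

variable {K : ℕ → ℝ}

lemma one_le_gluingScale_denom (hK : ∀ l, 0 ≤ K l) (l : ℕ) :
    1 ≤ 1 + ∑ i ∈ Finset.range l, K i :=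
  le_add_of_nonneg_right (Finset.sum_nonneg fun i _ => hK i)

lemma gluingScale_pos (hK : ∀ l, 0 ≤ K l) (l : ℕ) : 0 < gluingScale K l := by
  have := one_le_gluingScale_denom hK (l + 1)
  unfold gluingScale
  positivity

lemma gluingScale_le (hK : ∀ l, 0 ≤ K l) (l : ℕ) : gluingScale K l ≤ 1 / 4 * (1 / 32) ^ l :=
  div_le_self (by positivity) (one_le_gluingScale_denom hK _)

lemma gluingScale_le_pow (hK : ∀ l, 0 ≤ K l) (l : ℕ) : 4 * gluingScale K l ≤ (1 / 4) ^ l := by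
  have h1 := gluingScale_le hK l
  have h2 : (1 / 32 : ℝ) ^ l ≤ (1 / 4) ^ l := by
    gcongr
    norm_num
  linarith

/-- The base is `1/32 = 1/2 · (1/4)²`, matching the required bound `(1/2)^l R_l²` for `R_l =
(1/4)^l`. -/
lemma gluingScale_mul_le (hK : ∀ l, 0 ≤ K l) (l : ℕ) :
    gluingScale K l * K l ≤ (1 / 32) ^ l := by
  have h1 := one_le_gluingScale_denom hK (l + 1)
  have h2 : K l ≤ 1 + ∑ i ∈ Finset.range (l + 1), K i := by
    have := Finset.single_le_sum (f := K) (fun i _ => hK i)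
      (Finset.mem_range.2 (Nat.lt_succ_self l))
    linarith
  unfold gluingScale
  rw [div_mul_eq_mul_div, div_le_iff₀ (by linarith)]
  have h3 : (0 : ℝ) < (1 / 32) ^ l := by positivity
  nlinarith [hK l]

/-- The denominator contains a partial sum rather than `K l` alone precisely so that it is monotone.
-/
lemma strictAnti_gluingScale (hK : ∀ l, 0 ≤ K l) : StrictAnti (gluingScale K) := by
  refine strictAnti_nat_of_succ_lt fun l => ?_
  have h1 := one_le_gluingScale_denom hK (l + 1)
  unfold gluingScale
  refine div_lt_div₀ ?_ ?_ (by positivity) (by linarith)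
  · rw [pow_succ]
    have h3 : (0 : ℝ) < (1 / 32) ^ l := by positivity
    linarith
  · rw [Finset.sum_range_succ _ (l + 1)]
    linarith [hK (l + 1)]

end Scale

/-- The data of the construction: exponents along which `φ` is large. -/
lemma exists_exponents {φ : ℝ → ℝ} (hφ_lim : Tendsto φ atTop atTop) :
    ∃ T : ℕ → ℝ, ∀ l : ℕ, (l : ℝ) + 3 ≤ T l ∧ (4 : ℝ) ^ l ≤ φ (T l) := by
  -- The bound `l + 3` yields `t_l = 1/(2T_l) → 0` and `t_l < 1/4`; the bound `4^l` yields `ε_l ≤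
  -- 2^{-l}`.
  have h : ∀ l : ℕ, ∃ T : ℝ, (l : ℝ) + 3 ≤ T ∧ (4 : ℝ) ^ l ≤ φ T := fun l =>
    ((eventually_ge_atTop ((l : ℝ) + 3)).and (hφ_lim.eventually_ge_atTop _)).exists
  exact Classical.axiomOfChoice h

/-- The glued sum of real parts is the real part of the glued sum. -/
lemma IsGluable.re_gluedSum_eq_sum {n : ℕ} (hn : 2 ≤ n) {k : ℕ} {φ : ℝ → ℝ} {C M : ℝ}
    {R r t : ℕ → ℝ} (hψ : IsProfile (k + 2) M (cutProfile φ))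
    (h : IsGluable k C (fun l => 1 / √(φ (1 / (2 * t l)))) R r
      fun l x => (profileBlock hn k (cutProfile φ) (t l) x).re) :
    (fun x => (gluedSum hn k φ radialCutoff R r t x).re) = h.sum := by
  ext x
  have hzero : ∀ l, r l ≤ ‖x - R l • zetaZero n‖ →
      profileBlock hn k (cutProfile φ) (t l) ((r l)⁻¹ • (x - R l • zetaZero n)) = 0 := by
    intro l hl
    refine hψ.profileBlock_eq_zero ?_
    rw [norm_smul, norm_inv, Real.norm_of_nonneg (h.r_pos l).le, inv_mul_eq_div,
      one_le_div (h.r_pos l)]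
    exact hl
  -- At each point at most one term is nonzero, so the complex series is summable and `re` passes
  -- through it.
  have hs : ∃ s : Finset ℕ, ∀ l ∉ s,
      ((1 / √(φ (1 / (2 * t l))) * r l ^ (k + 2) : ℝ) : ℂ) *
        profileBlock hn k (cutProfile φ) (t l) ((r l)⁻¹ • (x - R l • zetaZero n)) = 0 := by
    by_cases hx : ∃ l, ‖x - R l • zetaZero n‖ < r l
    · obtain ⟨l, hl⟩ := hx
      refine ⟨{l}, fun m hm => ?_⟩
      rw [hzero m (h.le_norm_sub_of_ne hn (by simpa using hm) hl), mul_zero]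
    · push Not at hx
      exact ⟨∅, fun m _ => by rw [hzero m (hx m), mul_zero]⟩
  obtain ⟨s, hs⟩ := hs
  simp only [gluedSum, buildingBlock_eq_profileBlock]
  rw [Complex.re_tsum (summable_of_ne_finset_zero (s := s) hs)]
  simp only [Complex.re_ofReal_mul]
  rfl

/-! ### Assembly of the counterexample. -/

theorem theorem2 (n : ℕ) (hn : 2 ≤ n) (k : ℕ) (hk : 1 ≤ k) (φ : ℝ → ℝ)
    (hφ : ContDiffOn ℝ (k + 2 : ℕ) φ (Set.Ioi 0))
    (hφ_lim : Filter.Tendsto φ Filter.atTop Filter.atTop)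
    (hφ_deriv : ∀ j : ℕ, 1 ≤ j → j ≤ k + 2 →
      Filter.Tendsto (iteratedDeriv j φ) Filter.atTop (𝓝 0)) :
    ∃ u : EuclideanSpace ℝ (Fin n) → ℝ,
      (∃ (η : ℝ → ℝ) (R r t : ℕ → ℝ), IsRadialCutoff η ∧ IsGluingData φ R r t ∧
        ((u = fun x => (gluedSum hn k φ η R r t x).re) ∨
          (u = fun x => (gluedSum hn k φ η R r t x).im))) ∧
      HasCompactSupport u ∧
      TimesDifferentiable (k + 2) u ∧
      ContDiff ℝ k (Δ u) ∧
      (¬ ∃ C : ℝ, ∀ x, ‖iteratedFDeriv ℝ (k + 2) u x‖ ≤ C) ∧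
      ¬ ContDiff ℝ (k + 2 : ℕ) u := by
  obtain ⟨M, hM, hψ⟩ := exists_isProfile_cutProfile hφ hφ_deriv
  obtain ⟨C, hC⟩ := exists_isGluingBlock_re hn k hψ hM
  obtain ⟨T, hT⟩ := exists_exponents hφ_lim
  have hT3 : ∀ l, 3 ≤ T l := fun l => le_trans (by simp) (hT l).1
  set t : ℕ → ℝ := fun l => 1 / (2 * T l) with ht
  have hTt : ∀ l, 1 / (2 * t l) = T l := fun l => by
    have : T l ≠ 0 := by linarith [hT3 l]
    simp only [ht]
    field_simp
  have ht0 : ∀ l, 0 < t l := fun l => by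
    have := hT3 l
    simp only [ht]
    positivity
  have ht4 : ∀ l, t l < 1 / 4 := fun l => by
    have := hT3 l
    exact one_div_lt_one_div_of_lt (by norm_num) (by linarith)
  have hsqrt : ∀ l : ℕ, (2 : ℝ) ^ l ≤ √(φ (T l)) := fun l => by
    refine Real.le_sqrt_of_sq_le ?_
    rw [← pow_mul, mul_comm, pow_mul]
    norm_num
    exact (hT l).2
  have hφpos : ∀ l, 0 < φ (T l) := fun l => lt_of_lt_of_le (by positivity) (hT l).2
  set w : ℕ → EuclideanSpace ℝ (Fin n) → ℝ :=
    fun l x => (profileBlock hn k (cutProfile φ) (t l) x).re with hw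
  have hblock : ∀ l, IsGluingBlock k C (w l) := fun l => hC (t l) (ht0 l) (by linarith [ht4 l])
  -- The exponents, hence the blocks, are fixed before the scales: the radii must beat the bounds `K
  -- l`, which may grow with `l`.
  choose K hK0 hK using fun l => (hblock l).exists_bound
  set r := gluingScale K with hr
  set R : ℕ → ℝ := fun l => (1 / 4) ^ l with hR
  have hr0 := gluingScale_pos hK0
  have hr_anti := strictAnti_gluingScale hK0
  have hrR : ∀ l, 4 * r l ≤ R l := gluingScale_le_pow hK0
  have hR_anti : StrictAnti R := pow_right_strictAnti₀ (by norm_num) (by norm_num)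
  have hR_lim : Tendsto R atTop (𝓝 0) :=
    tendsto_pow_atTop_nhds_zero_of_lt_one (by norm_num) (by norm_num)
  have hr_lim : Tendsto r atTop (𝓝 0) :=
    squeeze_zero (fun l => (hr0 l).le) (fun l => by linarith [hrR l, hr0 l]) hR_lim
  have hsep : ∀ l, R (l + 1) + r (l + 1) < R l - r l := fun l => by
    have h1 : R (l + 1) = R l / 4 := by
      simp only [hR]
      ring
    have h2 := hr_anti (Nat.lt_succ_self l)
    have h3 := hr0 l
    have h4 := hrR l
    simp only [Nat.succ_eq_add_one] at h2
    linarith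
  have ht_lim : Tendsto t atTop (𝓝 0) := by
    refine squeeze_zero (fun l => (ht0 l).le) (fun l => ?_)
      tendsto_one_div_add_atTop_nhds_zero_nat
    exact one_div_le_one_div_of_le (by positivity) (by linarith [(hT l).1, hT3 l])
  have hdata : IsGluingData φ R r t :=
    { R_anti := hR_anti
      R_lim := hR_lim
      r_anti := hr_anti
      r_lim := hr_lim
      r_lt_R := fun l => by linarith [hrR l, hr0 l]
      separated := hsep
      t_pos := ht0
      t_lt := ht4
      t_lim := ht_lim
      φ_pos := fun l => by
        rw [hTt]
        exact hφpos l }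
  have hglue : IsGluable k C (fun l => 1 / √(φ (1 / (2 * t l)))) R r w :=
    { block := hblock
      ε_pos := fun l => by
        rw [hTt]
        exact one_div_pos.2 (Real.sqrt_pos.2 (hφpos l))
      ε_le := fun l => by
        rw [hTt, one_div_pow]
        exact one_div_le_one_div_of_le (by positivity) (hsqrt l)
      r_pos := hr0
      r_le_one := fun l => by
        have h1 : R l ≤ 1 := pow_le_one₀ (by norm_num) (by norm_num)
        linarith [hrR l, hr0 l]
      r_le := hrR
      r_anti := hr_anti.antitone
      R_anti := hR_anti.antitone
      R_lim := hR_lim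
      separated := fun l m hlm => by
        have h1 := hR_anti.antitone (Nat.succ_le_of_lt hlm)
        have h2 := hr_anti.antitone (Nat.succ_le_of_lt hlm)
        simp only [Nat.succ_eq_add_one] at h1 h2
        linarith [hsep l]
      small := fun l j hj x => by
        calc r l * ‖iteratedFDeriv ℝ j (w l) x‖ ≤ r l * K l :=
              mul_le_mul_of_nonneg_left (hK l j hj x) (hr0 l).le
          _ ≤ (1 / 32) ^ l := gluingScale_mul_le hK0 l
          _ = (1 / 2) ^ l * R l ^ 2 := by
              simp only [hR]
              rw [← pow_mul, mul_comm l 2, pow_mul, ← mul_pow]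
              norm_num }
  have hunb : ¬ ∃ A : ℝ, ∀ x, ‖iteratedFDeriv ℝ (k + 2) hglue.sum x‖ ≤ A := by
    refine hglue.not_bounded_iteratedFDeriv_sum hn fun A => ?_
    -- Since `ε φ = √φ ≥ 2^l`, it suffices that `2^l e^{-1/2} > A`.
    obtain ⟨l, hl⟩ := pow_unbounded_of_one_lt (A / Real.exp (-1 / 2)) one_lt_two
    obtain ⟨y, hy0, hy1, hy⟩ := exists_re_profileBlock_cutProfile hn k φ (ht0 l) (ht4 l)
    refine ⟨l, y, hy1, ?_⟩
    have he := Real.exp_pos (-1 / 2)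
    have h1 : 1 / √(φ (1 / (2 * t l))) * ‖w l y‖ =
        Real.exp (-1 / 2) * √(φ (T l)) * ‖y‖ ^ (k + 2) := by
      have hq : √(φ (T l)) ≠ 0 := (Real.sqrt_pos.2 (hφpos l)).ne'
      simp only [hw]
      rw [hy, hTt, Real.norm_of_nonneg (by have := hφpos l; positivity)]
      field_simp
      rw [Real.sq_sqrt (hφpos l).le]
    rw [h1]
    refine mul_lt_mul_of_pos_right ?_ (by positivity)
    rw [div_lt_iff₀ he] at hl
    calc A < 2 ^ l * Real.exp (-1 / 2) := hl
      _ ≤ √(φ (T l)) * Real.exp (-1 / 2) := mul_le_mul_of_nonneg_right (hsqrt l) he.le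
      _ = _ := mul_comm _ _
  have hcs := hglue.hasCompactSupport_sum
  refine ⟨hglue.sum, ⟨radialCutoff, R, r, t, isRadialCutoff_radialCutoff, hdata,
    Or.inl (hglue.re_gluedSum_eq_sum hn hψ).symm⟩, hcs, hglue.timesDifferentiable_sum hn,
    hglue.contDiff_laplacian_sum hk, hunb, fun hsm => hunb ?_⟩
  -- A continuous derivative of order `k + 2` with compact support would be bounded.
  exact (hsm.continuous_iteratedFDeriv le_rfl).bounded_above_of_compact_support
    (hcs.iteratedFDeriv (k + 2))
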